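/- **Setting.** Let $n,d\in\mathbb N$, $T>0$, a delay length $r\ge 0$, and exponents $\frac12<\lambda<\gamma$. For a function $g$ on an interval $[a,b]$ let $\|g\|_{\mu,[a,b]}=\sup_{s\ne t}|g_t-g_s|/|t-s|^\mu$, and let $\mathcal C_1^\mu([a,b];V)$ be the space of $V$-valued functions for which this is finite. For $a\le b$ and a path $Z$ on $[a-r,b]$ put $\mathcal Z^Z_s(\theta)=Z_{s+\theta}$ for $s\in[a,b]$, $\theta\in[-r,0]$. Let $\xi\in\mathcal C^\lambda_1([-r,0];\mathbb R^n)$, $x\in\mathcal C^\gamma_1([0,T];\mathbb R^d)$ and $f:\mathcal C^\lambda_1([-r,0];\mathbb R^n)\to\mathbb R^{n\times d}$. Write $[\mathcal U^{(a,b)}(Z)]_s=f(\mathcal Z^Z_s)$, $s\in[a,b]$, for $Z\in \mathcal C_1^\lambda([a-r,b];\mathbb R^n)$, and $\mathcal U^{(\mathbf t)}=\mathcal U^{(0,t)}$. Let $\mathcal C^\lambda_{\xi,0,t}(\mathbb R^n)$ (resp. $\mathcal C^\lambda_{0,0,t}(\mathbb R^n)$) be the set of $Z\in\mathcal C_1^\lambda([-r,t];\mathbb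 R^n)$ with $Z=\xi$ (resp. $Z=0$) on $[-r,0]$, with the distance (resp. norm) given by $\|\cdot\|_{\lambda,[-r,t]}$. Let $\mathcal C^\gamma_{0,0,T}(\mathbb R^d)$ and $\mathcal C^\lambda_{0,0,t}(\mathbb R^{n\times d})$ be the spaces of $\gamma$-Hölder functions on $[0,T]$ and of $\lambda$-Hölder functions on $[0,t]$, respectively, that vanish at $0$, normed by the Hölder seminorm. All integrals are Young integrals: $\int_s^t f_u\,dg_u=f_s(g_t-g_s)+R_{st}$, where $R$ is the unique continuous function of $(s,t)$ with $R_{ss}=0$, $\sup_{s\neq t}|R_{st}|/|t-s|^{\mu}<\infty$ for some $\mu>1$, and $R_{st}-R_{su}-R_{ut}=(f_u-f_s)(g_t-g_u)$ for all $s,u,t$. **Hypotheses.** * (H1) There is $M>0$ with $|f(\zeta)|\le M$ and $|f(\zeta_2)-f(\zeta_1)|\le M\sup_{\theta\in[-r,0]}|\zeta_2(\theta)-\zeta_1(\theta)|$ for all $\zeta,\zeta_1,\zeta_2\in\mathcal C_1^\lambda([-r,0];\mathbb R^n)$. * (H2) For every $N\ge1$ there is a constant $c_N$ such that $\|\mathcal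 U^{(a_1,a_2)}(Z_1)-\mathcal U^{(a_1,a_2)}(Z_2)\|_{\lambda,[a_1,a_2]}\le c_N\|Z_1-Z_2\|_{\lambda,[a_1-r,a_2]}$ for all $0\le a_1\le a_2\le T$ and all $Z_1,Z_2\in\mathcal C_1^\lambda([a_1-r,a_2];\mathbb R^n)$ that coincide on $[a_1-r,a_1]$ and satisfy $\|Z_i\|_{\lambda,[a_1-r,a_2]}\le N$, $i=1,2$. * (H3) For every $t\in(0,T]$ the map $\mathcal U^{(\mathbf t)}:\mathcal C^\lambda_{\xi,0,t}(\mathbb R^n)\to\mathcal C_1^\lambda([0,t];\mathbb R^{n\times d})$ is continuously Fréchet differentiable in the directions of $\mathcal C^\lambda_{0,0,t}(\mathbb R^n)$, with differential $\nabla\mathcal U^{(\mathbf t)}:\mathcal C^\lambda_{\xi,0,t}(\mathbb R^n)\to\mathcal L(\mathcal C^\lambda_{0,0,t}(\mathbb R^n);\mathcal C^\lambda_{0,0,t}(\mathbb R^{n\times d}))$; moreover, for $0<s<t\le T$ and $Z\in\mathcal C^\lambda_{0,0,T}(\mathbb R^n)$, $[\nabla\mathcal U^{(\mathbf t)}(y)](Z)=[\nabla\mathcal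 U^{(\mathbf s)}(y)](Z)$ on $[0,s]$, where $y$ is the solution in $\mathcal C^\lambda_{\xi,0,T}(\mathbb R^n)$ of $y_t=\xi_0+\int_0^tf(\mathcal Z^y_u)\,dx_u$, $t\in[0,T]$ (paths being restricted where necessary). **Proposition.** Assume (H1), (H2) and (H3). Then for every $h\in\mathcal C^\gamma_{0,0,T}(\mathbb R^d)$ the equation $$y_t=\xi_0+\int_0^t f(\mathcal Z^y_u)\,d(x+h)_u,\qquad t\in[0,T],$$ has a unique solution $y=y(x+h)$ in $\mathcal C^\lambda_{\xi,0,T}(\mathbb R^n)$. The map $h\mapsto y(x+h)$ from $\mathcal C^\gamma_{0,0,T}(\mathbb R^d)$ to $\mathcal C^\lambda_{\xi,0,T}(\mathbb R^n)$ is Fréchet differentiable at every $h$, that is, there is a bounded linear map $Dy(x+h):\mathcal C^\gamma_{0,0,T}(\mathbb R^d)\to\mathcal C^\lambda_{0,0,T}(\mathbb R^n)$ which is the Fréchet derivative at $h$ of $h'\mapsto y(x+h')-y(x+h)$. For all $h,k\in\mathcal C^\gamma_{0,0,T}(\mathbb R^d)$, the path $Dy(x+h)(k)$ is the unique solution $Z\in\mathcal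 C^\lambda_{0,0,T}(\mathbb R^n)$ of the linear Young equation $$Z_t=\int_0^t[\mathcal U^{(\mathbf T)}(y(x+h))]_s\,dk_s+\int_0^t[\nabla\mathcal U^{(\mathbf T)}(y(x+h))(Z)]_s\,d(x+h)_s,\qquad t\in[0,T].$$ In particular (take $h=0$), $Dy(x)(k)$ is the unique solution of $$[Dy(x)(k)]_t=\int_0^t[\mathcal U^{(\mathbf T)}(y(x))]_s\,dk_s+\int_0^t[\nabla\mathcal U^{(\mathbf T)}(y(x))(Dy(x)(k))]_s\,dx_s .$$ -/

import Mathlib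

open Set Topology
open scoped NNReal

noncomputable section

namespace YoungDelay

/-! ### Hölder spaces

The Hölder condition and seminorm are Mathlib's `HolderWith`, `MemHolder`, `nnHolderNorm`, applied to
functions on the compact interval `Icc a b`:
`nnHolderNorm α g = sup_{s ≠ t} |g_t - g_s| / |t - s| ^ α` for an `α`-Hölder function `g`. -/

/-- The space of `α`-Hölder functions `[a, b] → V`. -/
def HolderPath (α : ℝ≥0) (a b : ℝ) (V : Type*) [NormedAddCommGroup V] [NormedSpace ℝ V] :
    Submodule ℝ (Icc a b → V) where
  carrier := {g | MemHolder α g}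
  add_mem' hf hg := hf.add hg
  zero_mem' := memHolder_zero
  smul_mem' c _ hg := hg.smul (c := c)

/-- The linear space underlying `HolderZero`. -/
def holderZeroSubmodule (α : ℝ≥0) (a c b : ℝ) (V : Type*) [NormedAddCommGroup V]
    [NormedSpace ℝ V] : Submodule ℝ (Icc a b → V) where
  carrier := {g | MemHolder α g ∧ ∀ t : Icc a b, (t : ℝ) ≤ max a c → g t = 0}
  add_mem' hf hg := ⟨hf.1.add hg.1, fun t ht => by simp [hf.2 t ht, hg.2 t ht]⟩
  zero_mem' := ⟨memHolder_zero, fun _ _ => rfl⟩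
  smul_mem' c _ hg := ⟨hg.1.smul (c := c), fun t ht => by simp [hg.2 t ht]⟩

/-- For `a ≤ c`: the space of `α`-Hölder functions on `[a, b]` which vanish on `[a, c]`, normed by the
Hölder seminorm on `[a, b]`.  With `c = a` these are the Hölder functions that vanish at `a`.
(It is only used with `a ≤ c`, so that `max a c = c`.) -/
def HolderZero (α : ℝ≥0) (a c b : ℝ) (V : Type*) [NormedAddCommGroup V] [NormedSpace ℝ V] :
    Type _ :=
  holderZeroSubmodule α a c b V

section HolderZero

variable {α : ℝ≥0} {a c b : ℝ} {V : Type*} [NormedAddCommGroup V] [NormedSpace ℝ V]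

instance : AddCommGroup (HolderZero α a c b V) :=
  inferInstanceAs (AddCommGroup (holderZeroSubmodule α a c b V))

instance : Module ℝ (HolderZero α a c b V) :=
  inferInstanceAs (Module ℝ (holderZeroSubmodule α a c b V))

instance : CoeFun (HolderZero α a c b V) (fun _ => Icc a b → V) := ⟨fun g => g.1⟩

instance : NormedAddCommGroup (HolderZero α a c b V) :=
  AddGroupNorm.toNormedAddCommGroup
    { toFun := fun g => (nnHolderNorm α g.1 : ℝ)
      map_zero' := by
        change ((nnHolderNorm α (0 : Icc a b → V) : ℝ≥0) : ℝ) = 0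
        simp
      add_le' := fun f g => by
        have := f.2.1.nnHolderNorm_add_le g.2.1
        exact_mod_cast this
      neg' := fun f => by
        have h := f.2.1.nnHolderNorm_smul (-1 : ℝ)
        simp only [neg_smul, one_smul, nnnorm_neg, nnnorm_one, one_mul] at h
        exact_mod_cast h
      eq_zero_of_map_eq_zero' := fun f hf => by
        have h0 : nnHolderNorm α f.1 = 0 := by exact_mod_cast hf
        rw [f.2.1.nnHolderNorm_eq_zero] at h0
        apply Subtype.ext
        funext t
        have ha : a ≤ b := t.2.1.trans t.2.2
        rw [h0 t ⟨a, le_rfl, ha⟩, f.2.2 ⟨a, le_rfl, ha⟩ (le_max_left _ _)]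
        rfl }

theorem HolderZero.norm_def (g : HolderZero α a c b V) : ‖g‖ = (nnHolderNorm α g.1 : ℝ) := rfl

instance : NormedSpace ℝ (HolderZero α a c b V) where
  norm_smul_le r g := by
    rw [HolderZero.norm_def, HolderZero.norm_def]
    have h := g.2.1.nnHolderNorm_smul r
    have h' : ((nnHolderNorm α (r • g.1) : ℝ≥0) : ℝ) = ‖r‖ * (nnHolderNorm α g.1 : ℝ) := by
      rw [h]; simp
    exact h'.le

/-- Restriction to `[a, s]` for `s ≤ b`. -/
def HolderZero.restrict {s : ℝ} (hs : s ≤ b) (g : HolderZero α a c b V) :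
    HolderZero α a c s V :=
  ⟨fun t => g ⟨t, t.2.1, t.2.2.trans hs⟩,
    ⟨g.2.1.choose, fun u v => g.2.1.choose_spec ⟨u, u.2.1, u.2.2.trans hs⟩
      ⟨v, v.2.1, v.2.2.trans hs⟩⟩,
    fun t ht => g.2.2 ⟨t, t.2.1, t.2.2.trans hs⟩ ht⟩

end HolderZero

/-! ### The Young integral -/

/-- `R` is the image under the sewing map `Λ` of the `2`-increment `h` on `[a, b]`: it is a
`1`-increment (continuous, zero on the diagonal) with `‖R‖_μ < ∞` for some `μ > 1` and `δ R = h`,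
where `(δ R)_{sut} = R_{st} - R_{su} - R_{ut}`. Such an `R` is unique. -/
def IsSewing {a b : ℝ} {W : Type*} [NormedAddCommGroup W]
    (h : Icc a b → Icc a b → Icc a b → W) (R : Icc a b → Icc a b → W) : Prop :=
  Continuous (Function.uncurry R) ∧ (∀ t, R t t = 0) ∧
  (∃ μ C : ℝ, 1 < μ ∧ ∀ s t, ‖R s t‖ ≤ C * |(t : ℝ) - s| ^ μ) ∧
  ∀ s u t, R s t - R s u - R u t = h s u t

/-- `I_t = ∫_a^t f_u dg_u` for all `t ∈ [a, b]`, as a Young integral: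
`I_t - I_s = f_s (δ g)_{st} + Λ_{st}(δ f δ g)` for all `s, t`, and `I_a = 0`. -/
def IsYoungIntegral {a b : ℝ} {F W : Type*} [NormedAddCommGroup F] [NormedSpace ℝ F]
    [NormedAddCommGroup W] [NormedSpace ℝ W]
    (f : Icc a b → F →L[ℝ] W) (g : Icc a b → F) (I : Icc a b → W) : Prop :=
  (∀ t : Icc a b, (t : ℝ) = a → I t = 0) ∧
  ∃ R : Icc a b → Icc a b → W,
    IsSewing (fun s u t => (f u - f s) (g t - g u)) R ∧
    ∀ s t, I t - I s = f s (g t - g s) + R s t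

/-! ### Delay equations

`r ≥ 0` is the length of the delay. -/

section Delay

variable {lam r : ℝ≥0} {V M : Type*} [NormedAddCommGroup V] [NormedSpace ℝ V]

/-- The segment `𝒵^Z_s : [-r, 0] → V`, `θ ↦ Z_{s + θ}`, of a path `Z` on `[a - r, b]`, for
`s ∈ [a, b]`. -/
def segment {a b : ℝ} (Z : HolderPath lam (a - r) b V) (s : Icc a b) :
    HolderPath lam (-(r : ℝ)) 0 V :=
  ⟨fun θ => Z.1 ⟨s + θ, by linarith [s.2.1, θ.2.1], by linarith [s.2.2, θ.2.2]⟩, by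
    obtain ⟨C, hC⟩ := Z.2
    refine ⟨C, fun u v => (hC _ _).trans (le_of_eq ?_)⟩
    simp [Subtype.edist_eq]⟩

/-- The map `[𝒰 Z]_s = f(𝒵^Z_s)`, `s ∈ [a, b]`, for a path `Z` on `[a - r, b]`. -/
def delayMap (f : HolderPath lam (-(r : ℝ)) 0 V → M) {a b : ℝ}
    (Z : HolderPath lam (a - r) b V) (s : Icc a b) : M :=
  f (segment Z s)

/-- The space of `lam`-Hölder paths on `[-r, t]` which coincide with `ξ` on `[-r, 0]`. -/
def DelayedPath (ξ : HolderPath lam (-(r : ℝ)) 0 V) (t : ℝ) : Type _ :=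
  {Z : HolderPath lam (0 - r) t V //
    ∀ (s : Icc (0 - (r : ℝ)) t) (θ : Icc (-(r : ℝ)) 0), (s : ℝ) = θ → Z.1 s = ξ.1 θ}

/-- The space of directions of `DelayedPath ξ t`: `lam`-Hölder paths on `[-r, t]` which vanish on
`[-r, 0]`, with the Hölder norm on `[-r, t]`. -/
abbrev Direction (lam r : ℝ≥0) (V : Type*) [NormedAddCommGroup V] [NormedSpace ℝ V] (t : ℝ) :
    Type _ :=
  HolderZero lam (0 - r) 0 t V

variable {ξ : HolderPath lam (-(r : ℝ)) 0 V} {t : ℝ}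

/-- `ℓ +ᵥ Z` is the pointwise sum. -/
instance : VAdd (Direction lam r V t) (DelayedPath ξ t) :=
  ⟨fun ℓ Z => ⟨⟨ℓ.1 + Z.1.1, ℓ.2.1.add Z.1.2⟩, fun s θ h => by
    have h0 : ℓ.1 s = 0 := ℓ.2.2 s (by rw [h]; exact θ.2.2.trans (le_max_right _ _))
    simp [h0, Z.2 s θ h]⟩⟩

/-- `Z' -ᵥ Z` is the pointwise difference. -/
instance : VSub (Direction lam r V t) (DelayedPath ξ t) :=
  ⟨fun Z' Z => ⟨Z'.1.1 - Z.1.1, (Z'.1 - Z.1).2, fun s hs => by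
    have h0 : (s : ℝ) ≤ 0 := by
      have : (0 : ℝ) - r ≤ 0 := by simp
      rwa [max_eq_right this] at hs
    have h1 : -(r : ℝ) ≤ s := by linarith [s.2.1]
    have e' := Z'.2 s ⟨s, h1, h0⟩ rfl
    have e := Z.2 s ⟨s, h1, h0⟩ rfl
    simp [e, e']⟩⟩

/-- Restriction to `[-r, s]` for `s ≤ t`. -/
def DelayedPath.restrict {s : ℝ} (hs : s ≤ t) (Z : DelayedPath ξ t) : DelayedPath ξ s :=
  ⟨⟨fun u => Z.1.1 ⟨u, u.2.1, u.2.2.trans hs⟩,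
    Z.1.2.choose, fun u v => Z.1.2.choose_spec ⟨u, u.2.1, u.2.2.trans hs⟩
      ⟨v, v.2.1, v.2.2.trans hs⟩⟩,
    fun u θ h => Z.2 ⟨u, u.2.1, u.2.2.trans hs⟩ θ h⟩

/-- The point `u ∈ [0, t]` as a point of `[-r, t]`. -/
def incl (r : ℝ≥0) {t : ℝ} (u : Icc 0 t) : Icc (0 - (r : ℝ)) t :=
  ⟨u, by have := r.2; linarith [u.2.1, r.coe_nonneg], u.2.2⟩

/-- The value `ξ_0` of the initial condition at time `0`. -/
def valueAtZero (ξ : HolderPath lam (-(r : ℝ)) 0 V) : V :=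
  ξ.1 ⟨0, by simp, le_rfl⟩

variable [NormedAddCommGroup M]

/-- Boundedness and Lipschitz continuity of the coefficient in the uniform norm. -/
def Hypothesis1 (f : HolderPath lam (-(r : ℝ)) 0 V → M) : Prop :=
  ∃ K : ℝ, 0 < K ∧ (∀ ζ, ‖f ζ‖ ≤ K) ∧
    ∀ ζ₁ ζ₂, ‖f ζ₂ - f ζ₁‖ ≤ K * ⨆ θ : Icc (-(r : ℝ)) 0, ‖ζ₂.1 θ - ζ₁.1 θ‖

/-- Local Lipschitz continuity of `𝒰` in Hölder norm, uniformly over the intervals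
`[a₁, a₂] ⊆ [0, T]`, among paths on `[a₁ - r, a₂]` which share their initial condition on
`[a₁ - r, a₁]`. -/
def Hypothesis2 (T : ℝ) (f : HolderPath lam (-(r : ℝ)) 0 V → M) : Prop :=
  ∀ N : ℝ≥0, 1 ≤ N → ∃ c : ℝ≥0, ∀ a₁ a₂ : ℝ, 0 ≤ a₁ → a₁ ≤ a₂ → a₂ ≤ T →
    ∀ Z₁ Z₂ : HolderPath lam (a₁ - r) a₂ V,
      (∀ t : Icc (a₁ - (r : ℝ)) a₂, (t : ℝ) ≤ a₁ → Z₁.1 t = Z₂.1 t) →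
      max (nnHolderNorm lam Z₁.1) (nnHolderNorm lam Z₂.1) ≤ N →
      HolderWith (c * nnHolderNorm lam (Z₁.1 - Z₂.1)) lam
        (fun s : Icc a₁ a₂ => delayMap f Z₁ s - delayMap f Z₂ s)

variable [NormedSpace ℝ M]

/-- `A` is the Fréchet derivative at `Z` of `𝒰 : DelayedPath ξ t → C^lam([0, t]; M)` in the
directions of `Direction lam r V t`: for every `ε > 0`,
`‖𝒰(Z + ℓ) - 𝒰(Z) - A ℓ‖_{lam, [0, t]} ≤ ε ‖ℓ‖` for all small enough `ℓ`. -/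
def HasDelayMapDerivAt (f : HolderPath lam (-(r : ℝ)) 0 V → M) (Z : DelayedPath ξ t)
    (A : Direction lam r V t →L[ℝ] HolderZero lam 0 0 t M) : Prop :=
  ∀ ε : ℝ≥0, 0 < ε → ∀ᶠ ℓ in 𝓝 (0 : Direction lam r V t),
    HolderWith (ε * ‖ℓ‖₊) lam
      (fun s : Icc 0 t => delayMap f (ℓ +ᵥ Z).1 s - delayMap f Z.1 s - (A ℓ) s)

end Delay

section Equation

variable {lam r : ℝ≥0} {V F : Type*} [NormedAddCommGroup V] [NormedSpace ℝ V]
  [NormedAddCommGroup F] [NormedSpace ℝ F] {ξ : HolderPath lam (-(r : ℝ)) 0 V} {T : ℝ}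

/-- `y`, which coincides with `ξ` on `[-r, 0]`, solves the Young delay equation
`y_t = ξ_0 + ∫_0^t f(𝒵^y_u) dx_u`, `t ∈ [0, T]`. -/
def IsSolution (f : HolderPath lam (-(r : ℝ)) 0 V → F →L[ℝ] V) (x : Icc 0 T → F)
    (y : DelayedPath ξ T) : Prop :=
  ∃ I : Icc 0 T → V, IsYoungIntegral (delayMap f y.1) x I ∧
    ∀ t : Icc 0 T, y.1.1 (incl r t) = valueAtZero ξ + I t

/-- For every `t ∈ (0, T]`, the map `𝒰` on paths over `[-r, t]` is continuously Fréchet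
differentiable with differential `DU t`, and along the solution `y` of the equation driven by `x`
the differentials are consistent: `DU t (y) (Z) = DU s (y) (Z)` on `[0, s]` for `s < t`. -/
structure Hypothesis3 (f : HolderPath lam (-(r : ℝ)) 0 V → F →L[ℝ] V)
    (ξ : HolderPath lam (-(r : ℝ)) 0 V) (x : Icc 0 T → F)
    (DU : ∀ t : ℝ, DelayedPath ξ t →
      (Direction lam r V t →L[ℝ] HolderZero lam 0 0 t (F →L[ℝ] V))) : Prop where
  hasDeriv : ∀ t, 0 < t → t ≤ T → ∀ Z, HasDelayMapDerivAt f Z (DU t Z)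
  continuous : ∀ t, 0 < t → t ≤ T → ∀ Z : DelayedPath ξ t,
    ContinuousAt (fun ℓ : Direction lam r V t => DU t (ℓ +ᵥ Z)) 0
  consistent : ∀ y : DelayedPath ξ T, IsSolution f x y →
    ∀ (s t : ℝ) (_ : 0 < s) (hst : s < t) (htT : t ≤ T) (Z : Direction lam r V T),
      (DU t (y.restrict htT) (Z.restrict htT)).restrict hst.le =
        DU s (y.restrict (hst.le.trans htT)) (Z.restrict (hst.le.trans htT))

/-- `Z` solves the linear Young equation
`Z_t = ∫_0^t 𝒰(y)_s dk_s + ∫_0^t [A(Z)]_s dx_s`, `t ∈ [0, T]`. -/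
def IsLinearSolution (f : HolderPath lam (-(r : ℝ)) 0 V → F →L[ℝ] V) (x : Icc 0 T → F)
    (y : DelayedPath ξ T) (A : Direction lam r V T →L[ℝ] HolderZero lam 0 0 T (F →L[ℝ] V))
    (k : Icc 0 T → F) (Z : Direction lam r V T) : Prop :=
  ∃ I J : Icc 0 T → V,
    IsYoungIntegral (delayMap f y.1) k I ∧ IsYoungIntegral (A Z) x J ∧
    ∀ t : Icc 0 T, Z (incl r t) = I t + J t

end Equation

end YoungDelay

end

open YoungDelay

/-!
The equation is solved in the affine space of delayed paths over the fixed interval `[-r, T]`: a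
path is the base path `basePath ξ T`, which continues `ξ` by a constant, plus a direction `ℓ` in a
Banach space of Hölder functions. In these coordinates the equation reads `ℓ = rhs ℓ`, where
`rhs ℓ = ∫ f(𝒵^y) d(x + h)` is causal.

*Young integration.* The integral is the limit of Riemann sums over dyadic grids. The Young–Loève
estimate `exists_young_integral` comes from comparing consecutive grids, starting at the grid whose
mesh is comparable to `t - s`. Since the driver has a Hölder exponent `γ > lam`, the
`lam`-Hölder norm of an integral over `[a, b]` carries a factor `(b - a) ^ (γ - lam)`
(`norm_stopAt_youngLin_sub_le`).

*Short time steps.* Instead of varying the interval, paths are stopped: the operators `stopAt τ` of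
norm at most one turn every statement on `[0, τ]` into one on the whole space. For a causal map
which is small over short time steps, `IsStopping.existsUnique_fixedPoint` gives a unique global
fixed point. The uniform Lipschitz bound on `f` gives linear growth and hence an a priori bound on
all solutions; the local Lipschitz bound in Hölder norm then makes each step a contraction. In the
linear case, `IsStopping.isInvertible_id_sub` shows that `1 - L` is invertible for a causal operator
`L` of this kind.

*Differentiability.* The map `(h, ℓ) ↦ ℓ - rhs ℓ` is continuously differentiable, because the Young
integral is bilinear and bounded and the delay map is continuously differentiable. Its partial
derivative in `ℓ` is `Z ↦ Z - ∫ ∇𝒰(y)(Z) d(x + h)`. The delay map is causal, so its derivative is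
causal as well (`HasDelayMapDerivAt.stopAt_eq_zero`), and the partial derivative is invertible. The
implicit function theorem yields local solutions that are differentiable in `h`; by uniqueness they
are the global ones, and the formula for the derivative is the linear Young equation.
-/

noncomputable section

namespace YoungDelay

/-! ### Causal equations in a Banach space with stopping operators -/

section Causal

variable {X : Type*} [NormedAddCommGroup X] [NormedSpace ℝ X]

/-- An abstract family of operators `x ↦ x_{· ∧ τ}` which stop a path at the time `τ ∈ [0, T]`. -/
structure IsStopping (E : ℝ → X →L[ℝ] X) (T : ℝ) : Prop where
  zero : E 0 = 0
  final : E T = ContinuousLinearMap.id ℝ X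
  norm_le : ∀ τ x, ‖E τ x‖ ≤ ‖x‖
  comp_left : ∀ a b x, 0 ≤ a → a ≤ b → E a (E b x) = E a x
  comp_right : ∀ a b x, 0 ≤ a → a ≤ b → E b (E a x) = E a x

/-- A property of times which holds at `0` and propagates over steps of length at most `δ` holds on
all of `[0, T]`. -/
theorem forall_of_small_steps {T δ : ℝ} (hδ : 0 < δ) {p : ℝ → Prop} (h0 : p 0)
    (hstep : ∀ a b, 0 ≤ a → a ≤ b → b ≤ T → b - a ≤ δ → p a → p b) {τ : ℝ} (hτ0 : 0 ≤ τ)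
    (hτ : τ ≤ T) : p τ := by
  have key : ∀ j : ℕ, p (min (j * δ) τ) := by
    intro j
    induction j with
    | zero => simpa [hτ0] using h0
    | succ j ih =>
      have h1 : min (j * δ) τ ≤ min ((j + 1 : ℕ) * δ) τ := by
        gcongr; omega
      refine hstep _ _ (le_min (by positivity) hτ0) h1 ((min_le_right _ _).trans hτ) ?_ ih
      push_cast
      rcases le_total (j * δ) τ with h | h
      · rw [min_eq_left h]
        linarith [min_le_left ((j + 1) * δ) τ]
      · rw [min_eq_right h]
        linarith [min_le_right ((j + 1) * δ) τ]
  obtain ⟨n, hn⟩ := exists_nat_gt (τ / δ)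
  have := key n
  rwa [min_eq_right ((div_lt_iff₀ hδ).1 hn).le] at this

variable {E : ℝ → X →L[ℝ] X} {T : ℝ}

/-- A causal bounded operator `L` which is small over short time intervals makes `1 - L`
invertible: the equation `x - L x = g` is solved on one short interval after the other, by a Neumann
series on each of them. -/
theorem IsStopping.isInvertible_id_sub [CompleteSpace X] (hE : IsStopping E T) (hT : 0 ≤ T)
    {L : X →L[ℝ] X}
    (hcausal : ∀ τ x, 0 ≤ τ → τ ≤ T → E τ x = 0 → E τ (L x) = 0) {δ : ℝ} (hδ : 0 < δ)
    (hsmall : ∀ a b x, 0 ≤ a → a ≤ b → b ≤ T → b - a ≤ δ → E a x = 0 →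
      ‖E b (L x)‖ ≤ 1 / 4 * ‖x‖) :
    (ContinuousLinearMap.id ℝ X - L).IsInvertible := by
  have hcausal' : ∀ τ x, 0 ≤ τ → τ ≤ T → E τ (L (E τ x)) = E τ (L x) := by
    intro τ x h0 h1
    have := hcausal τ (E τ x - x) h0 h1 (by rw [map_sub, hE.comp_left _ _ _ h0 le_rfl, sub_self])
    rwa [map_sub, map_sub, sub_eq_zero] at this
  have inj : Function.Injective (ContinuousLinearMap.id ℝ X - L) := by
    refine (injective_iff_map_eq_zero _).2 fun x hx => ?_
    have hx : x = L x := by simpa [sub_eq_zero] using hx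
    have : E T x = 0 := by
      refine forall_of_small_steps (p := fun τ => E τ x = 0) hδ (by simp [hE.zero]) ?_ hT le_rfl
      intro a b ha hab hb hba h
      have h1 := hsmall a b (E b x) ha hab hb hba (by rw [hE.comp_left _ _ _ ha hab, h])
      rw [hcausal' b x (ha.trans hab) hb, ← hx] at h1
      have := norm_nonneg (E b x)
      exact norm_eq_zero.1 (by linarith)
    simpa [hE.final] using this
  have surj : Function.Surjective (ContinuousLinearMap.id ℝ X - L) := by
    intro g
    have : ∃ x, E T (g - (x - L x)) = 0 := by
      refine forall_of_small_steps (p := fun τ => ∃ x, E τ (g - (x - L x)) = 0) hδ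
        ⟨0, by simp [hE.zero]⟩ ?_ hT le_rfl
      rintro a b ha hab hb hba ⟨x, hx⟩
      set g' := g - (x - L x) with hg'
      have hb0 := ha.trans hab
      -- the equation on `[a, b]`, for paths which vanish up to `a` and are stopped at `b`
      set K : X →L[ℝ] X := (E b).comp (L.comp (E b - E a)) with hK
      have hQ : ∀ z, E a ((E b - E a) z) = 0 := fun z => by
        rw [sub_apply, map_sub, hE.comp_left _ _ _ ha hab, hE.comp_left _ _ _ ha le_rfl, sub_self]
      have hKn : ‖K‖ < 1 := by
        refine lt_of_le_of_lt (ContinuousLinearMap.opNorm_le_bound _ (M := 1 / 2) (by norm_num)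
          fun z => ?_) (by norm_num)
        have h1 := hsmall a b ((E b - E a) z) ha hab hb hba (hQ z)
        have h2 : ‖(E b - E a) z‖ ≤ ‖z‖ + ‖z‖ :=
          (norm_sub_le _ _).trans (add_le_add (hE.norm_le _ _) (hE.norm_le _ _))
        calc ‖K z‖ = ‖E b (L ((E b - E a) z))‖ := rfl
          _ ≤ 1 / 2 * ‖z‖ := by linarith
      have hunit : IsUnit (1 - K) := isUnit_one_sub_of_norm_lt_one hKn
      obtain ⟨R, hR⟩ := hunit.exists_right_inv
      set w := R (E b g') with hw
      have hweq : w = K w + E b g' := by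
        have := congrArg (fun A : X →L[ℝ] X => A (E b g')) hR
        have h : w - K w = E b g' := this
        rw [← h]; abel
      have hEb : E b w = w := by
        rw [hweq, map_add, hE.comp_left _ _ _ hb0 le_rfl]
        congr 1
        exact hE.comp_left _ _ _ hb0 le_rfl
      have hEa : E a w = 0 := by
        rw [hweq, map_add, hE.comp_left _ _ _ ha hab, hx, add_zero]
        change E a (E b (L ((E b - E a) w))) = 0
        rw [hE.comp_left _ _ _ ha hab]
        exact hcausal a _ ha (hab.trans hb) (hQ w)
      have hKw : K w = E b (L w) := by
        change E b (L (E b w - E a w)) = _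
        rw [hEa, hEb, sub_zero]
      refine ⟨x + w, ?_⟩
      have e : g - (x + w - L (x + w)) = g' - (w - L w) := by
        rw [hg', map_add]; abel
      rw [e, map_sub, map_sub (E b) w, hEb, ← hKw, sub_eq_zero, eq_sub_iff_add_eq, add_comm]
      exact hweq.symm
    obtain ⟨x, hx⟩ := this
    refine ⟨x, ?_⟩
    rw [hE.final] at hx
    exact (sub_eq_zero.1 hx).symm
  exact ⟨ContinuousLinearEquiv.ofBijective _ (LinearMap.ker_eq_bot.2 inj)
    (LinearMap.range_eq_top.2 surj), by ext; rfl⟩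

/-- Existence and uniqueness for a causal equation `x = G x` whose right-hand side has linear
growth and is locally Lipschitz, both with small constants over short time intervals. The growth
bound confines all solutions to a ball, so that one step length serves for all steps. -/
theorem IsStopping.existsUnique_fixedPoint [CompleteSpace X] (hE : IsStopping E T) (hT : 0 ≤ T)
    {G : X → X}
    (hcausal : ∀ τ x y, 0 ≤ τ → τ ≤ T → E τ x = E τ y → E τ (G x) = E τ (G y)) {δ₀ : ℝ}
    (hδ₀ : 0 < δ₀)
    (hgrowth : ∀ a b x, 0 ≤ a → a ≤ b → b ≤ T → b - a ≤ δ₀ →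
      ‖E b (G x) - E a (G x)‖ ≤ 1 / 2 * (1 + ‖x‖))
    (hlip : ∀ R : ℝ, ∃ δ > 0, ∀ a b x y, 0 ≤ a → a ≤ b → b ≤ T → b - a ≤ δ → ‖x‖ ≤ R → ‖y‖ ≤ R →
      E a x = E a y → ‖E b (G x) - E b (G y)‖ ≤ 1 / 2 * ‖x - y‖) :
    ∃! x, G x = x := by
  have hcausal' : ∀ τ x, 0 ≤ τ → τ ≤ T → E τ (G (E τ x)) = E τ (G x) := fun τ x h0 h1 =>
    hcausal τ _ _ h0 h1 (hE.comp_left _ _ _ h0 le_rfl)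
  obtain ⟨N, hN⟩ : ∃ N : ℝ, ∀ τ x, 0 ≤ τ → τ ≤ T → E τ (G x) = x → ‖x‖ ≤ N := by
    obtain ⟨n, hn⟩ := exists_nat_gt (T / δ₀)
    refine ⟨2 ^ n, fun τ x h0 h1 hx => ?_⟩
    have key : ∀ j : ℕ, 1 + ‖E (min (j * δ₀) τ) x‖ ≤ 2 ^ j := by
      intro j
      induction j with
      | zero => simp [h0, hE.zero]
      | succ j ih =>
        set a := min (j * δ₀) τ with ha
        set b := min ((j + 1 : ℕ) * δ₀) τ with hb
        have hab : a ≤ b := by rw [ha, hb]; gcongr; omega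
        have ha0 : 0 ≤ a := le_min (by positivity) h0
        have hb0 := ha0.trans hab
        have hbτ : b ≤ τ := min_le_right _ _
        have hba : b - a ≤ δ₀ := by
          rw [ha, hb]; push_cast
          rcases le_total (j * δ₀) τ with h | h
          · rw [min_eq_left h]
            linarith [min_le_left ((j + 1) * δ₀) τ]
          · rw [min_eq_right h]
            linarith [min_le_right ((j + 1) * δ₀) τ]
        have hEx : ∀ σ, 0 ≤ σ → σ ≤ τ → E σ (G x) = E σ x := fun σ hσ hστ => by
          conv_rhs => rw [← hx, hE.comp_left _ _ _ hσ hστ]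
        have h2 := hgrowth a b (E b x) ha0 hab (hbτ.trans h1) hba
        rw [hcausal' b x hb0 (hbτ.trans h1)] at h2
        have h3 : E a (G (E b x)) = E a (G x) :=
          hcausal a _ _ ha0 (hab.trans (hbτ.trans h1)) (hE.comp_left _ _ _ ha0 hab)
        rw [h3, hEx b hb0 hbτ, hEx a ha0 (hab.trans hbτ)] at h2
        have h4 := norm_sub_norm_le (E b x) (E a x)
        rw [pow_succ]
        linarith
    have h3 := key n
    have hlt := (div_lt_iff₀ hδ₀).1 hn
    rw [min_eq_right (h1.trans hlt.le)] at h3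
    have h4 : E τ x = x := by
      conv_rhs => rw [← hx, ← hE.comp_left _ _ _ h0 le_rfl, hx]
    rw [h4] at h3
    linarith
  obtain ⟨δ₁, hδ₁, hlip⟩ := hlip (2 * N + 1)
  have hδ : 0 < min δ₀ δ₁ := lt_min hδ₀ hδ₁
  have hself : ∀ τ x, 0 ≤ τ → E τ (G x) = x → E τ x = x := fun τ x h0 hx => by
    conv_lhs => rw [← hx, hE.comp_left _ _ _ h0 le_rfl, hx]
  have hN0 : ∀ {x : X}, ‖x‖ ≤ N → ‖x‖ ≤ 2 * N + 1 := fun {x} h => by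
    linarith [norm_nonneg x]
  obtain ⟨x, hx⟩ : ∃ x, E T (G x) = x := by
    refine forall_of_small_steps (p := fun τ => ∃ x, E τ (G x) = x) hδ ⟨0, by simp [hE.zero]⟩ ?_
      hT le_rfl
    rintro a b ha hab hb hba ⟨x, hx⟩
    have hb0 := ha.trans hab
    have haT := hab.trans hb
    have hxa := hself a x ha hx
    have hxN := hN a x ha haT hx
    set S : Set X := {y | E a y = x ∧ E b y = y ∧ ‖y‖ ≤ 2 * N + 1} with hS
    have hSc : IsClosed S := by
      refine (isClosed_eq (E a).continuous continuous_const).inter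
        ((isClosed_eq (E b).continuous continuous_id).inter
          (isClosed_le continuous_norm continuous_const))
    have hxS : x ∈ S := ⟨hxa, by rw [← hxa, hE.comp_right _ _ _ ha hab], hN0 hxN⟩
    have hmaps : MapsTo (fun y => E b (G y)) S S := by
      rintro y ⟨h1, h2, h3⟩
      have h4 : E a (G y) = x := by
        rw [hcausal a y x ha haT (by rw [h1, hxa]), hx]
      refine ⟨by rw [hE.comp_left _ _ _ ha hab, h4], hE.comp_left _ _ _ hb0 le_rfl, ?_⟩
      have h5 := hgrowth a b y ha hab hb (hba.trans (min_le_left _ _))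
      rw [h4] at h5
      have h6 := norm_sub_norm_le (E b (G y)) x
      simp only
      linarith
    have hcon : ContractingWith (1 / 2 : ℝ≥0) (hmaps.restrict (fun y => E b (G y)) S S) := by
      refine ⟨by rw [← NNReal.coe_lt_coe]; norm_num, LipschitzWith.of_dist_le_mul ?_⟩
      rintro ⟨y, hy⟩ ⟨z, hz⟩
      have := hlip a b y z ha hab hb (hba.trans (min_le_right _ _)) hy.2.2 hz.2.2
        (by rw [hy.1, hz.1])
      simpa [Subtype.dist_eq, dist_eq_norm] using this
    obtain ⟨y, -, hy, -⟩ := hcon.exists_fixedPoint' hSc.isComplete hmaps hxS (edist_ne_top _ _)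
    exact ⟨y, hy⟩
  have hfix : ∀ {y}, G y = y → E T (G y) = y := fun {y} h => by rw [h, hE.final]; rfl
  refine ⟨x, ?_, fun y hy => ?_⟩
  · rw [hE.final] at hx
    exact hx
  have hxG : G x = x := by
    rw [hE.final] at hx
    exact hx
  have hxN := hN T x hT le_rfl hx
  have hyN := hN T y hT le_rfl (hfix hy)
  have : E T y = E T x := by
    refine forall_of_small_steps (p := fun τ => E τ y = E τ x) hδ (by simp [hE.zero]) ?_ hT le_rfl
    intro a b ha hab hb hba h
    have hb0 := ha.trans hab
    have h1 := hlip a b (E b y) (E b x) ha hab hb (hba.trans (min_le_right _ _))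
      ((hE.norm_le _ _).trans (hN0 hyN)) ((hE.norm_le _ _).trans (hN0 hxN))
      (by rw [hE.comp_left _ _ _ ha hab, hE.comp_left _ _ _ ha hab, h])
    rw [hcausal' b _ hb0 hb, hcausal' b _ hb0 hb, hxG, hy] at h1
    have := norm_nonneg (E b y - E b x)
    exact sub_eq_zero.1 (norm_eq_zero.1 (by linarith))
  simpa [hE.final] using this

end Causal

/-! ### Riemann sums along dyadic grids -/

section Dyadic

variable {F W : Type*} [NormedAddCommGroup F] [NormedSpace ℝ F] [NormedAddCommGroup W]
  [NormedSpace ℝ W] (f : ℝ → F →L[ℝ] W) (g : ℝ → F)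

/-- The left-point Riemann sum of `∫_0^{k h} f dg` along the grid `h ℕ`. -/
def gridSum (h : ℝ) (k : ℕ) : W :=
  ∑ j ∈ Finset.range k, f (j * h) (g ((j + 1 : ℕ) * h) - g (j * h))

/-- The Riemann sum over the grid points from `a h` to `b h`, compensated by the one-step
approximation of the integral over `[a h, b h]`. -/
def gridDefect (h : ℝ) (a b : ℕ) : W :=
  gridSum f g h b - gridSum f g h a - f (a * h) (g (b * h) - g (a * h))

variable {f g}

theorem gridSum_succ (h : ℝ) (k : ℕ) : gridSum f g h (k + 1) =
    gridSum f g h k + f (k * h) (g ((k + 1 : ℕ) * h) - g (k * h)) :=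
  Finset.sum_range_succ _ _

theorem gridDefect_self (h : ℝ) (a : ℕ) : gridDefect f g h a a = 0 := by
  simp [gridDefect]

theorem gridDefect_succ (h : ℝ) (a : ℕ) : gridDefect f g h a (a + 1) = 0 := by
  simp [gridDefect, gridSum_succ]

/-- Merging the intervals of the grid `h ℕ` in pairs changes the Riemann sum by second order
increments. -/
theorem gridSum_two_mul (h : ℝ) (k : ℕ) : gridSum f g h (2 * k) = gridSum f g (2 * h) k +
    ∑ j ∈ Finset.range k, (f ((2 * j + 1 : ℕ) * h) - f ((2 * j : ℕ) * h))
      (g ((2 * j + 2 : ℕ) * h) - g ((2 * j + 1 : ℕ) * h)) := by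
  induction k with
  | zero => simp [gridSum]
  | succ k ih =>
    rw [Finset.sum_range_succ, show 2 * (k + 1) = 2 * k + 1 + 1 by ring, gridSum_succ,
      gridSum_succ, ih, gridSum_succ]
    have e1 : (k : ℝ) * (2 * h) = (2 * k : ℕ) * h := by push_cast; ring
    have e2 : ((k + 1 : ℕ) : ℝ) * (2 * h) = (2 * k + 2 : ℕ) * h := by push_cast; ring
    rw [e1, e2]
    simp only [map_sub, sub_apply, show 2 * k + 1 + 1 = 2 * k + 2 from rfl]
    abel

theorem gridSum_of_div_two_eq (h : ℝ) {a a' : ℕ} (ha : a' / 2 = a) :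
    gridSum f g h a' = gridSum f g h (2 * a) +
      f ((2 * a : ℕ) * h) (g (a' * h) - g ((2 * a : ℕ) * h)) := by
  obtain rfl | rfl : a' = 2 * a ∨ a' = 2 * a + 1 := by omega
  · simp
  · rw [gridSum_succ]

variable {l c Kf Kg : ℝ}

/-- Refining the grid by a factor of two changes the defect by second order increments of `f` and
`g` only. -/
theorem norm_gridDefect_sub_le (hl : 0 < l) (hc : 0 < c) (hKf : 0 ≤ Kf) (hKg : 0 ≤ Kg)
    (hf : ∀ s t, ‖f t - f s‖ ≤ Kf * |t - s| ^ l) (hg : ∀ s t, ‖g t - g s‖ ≤ Kg * |t - s| ^ c)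
    {h : ℝ} (hh : 0 < h) {a b a' b' : ℕ} (hab : a ≤ b) (hab' : a' ≤ b') (ha : a' / 2 = a)
    (hb : b' / 2 = b) :
    ‖gridDefect f g h a' b' - gridDefect f g (2 * h) a b‖ ≤
      Kf * Kg * (((b : ℝ) - a) * (h ^ l * h ^ c) + h ^ l * (((b' : ℝ) - a') * h) ^ c
        + (2 * ((b : ℝ) - a) * h) ^ l * h ^ c) := by
  set e : ℕ → W := fun j => (f ((2 * j + 1 : ℕ) * h) - f ((2 * j : ℕ) * h))
      (g ((2 * j + 2 : ℕ) * h) - g ((2 * j + 1 : ℕ) * h)) with he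
  -- besides the merged pairs, only the half intervals at both ends contribute
  have key : gridDefect f g h a' b' - gridDefect f g (2 * h) a b =
      ∑ j ∈ Finset.Ico a b, e j
      - (f (a' * h) - f ((2 * a : ℕ) * h)) (g (b' * h) - g (a' * h))
      + (f ((2 * b : ℕ) * h) - f ((2 * a : ℕ) * h)) (g (b' * h) - g ((2 * b : ℕ) * h)) := by
    rw [Finset.sum_Ico_eq_sub _ hab]
    simp only [gridDefect]
    rw [gridSum_of_div_two_eq h ha, gridSum_of_div_two_eq h hb, gridSum_two_mul, gridSum_two_mul]
    have e1 : (a : ℝ) * (2 * h) = (2 * a : ℕ) * h := by push_cast; ring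
    have e2 : (b : ℝ) * (2 * h) = (2 * b : ℕ) * h := by push_cast; ring
    rw [e1, e2]
    simp only [map_sub, sub_apply, he]
    abel
  have bil : ∀ s u v w, ‖(f u - f s) (g w - g v)‖ ≤ Kf * Kg * (|u - s| ^ l * |w - v| ^ c) := by
    intro s u v w
    calc _ ≤ ‖f u - f s‖ * ‖g w - g v‖ := ContinuousLinearMap.le_opNorm _ _
      _ ≤ (Kf * |u - s| ^ l) * (Kg * |w - v| ^ c) := by gcongr <;> [exact hf _ _; exact hg _ _]
      _ = _ := by ring
  have hsum : ‖∑ j ∈ Finset.Ico a b, e j‖ ≤ Kf * Kg * (((b : ℝ) - a) * (h ^ l * h ^ c)) := by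
    calc _ ≤ ∑ j ∈ Finset.Ico a b, Kf * Kg * (h ^ l * h ^ c) := by
          refine norm_sum_le_of_le _ fun j _ => ?_
          refine (bil _ _ _ _).trans (le_of_eq ?_)
          have i1 : ((2 * j + 1 : ℕ) : ℝ) * h - (2 * j : ℕ) * h = h := by push_cast; ring
          have i2 : ((2 * j + 2 : ℕ) : ℝ) * h - (2 * j + 1 : ℕ) * h = h := by push_cast; ring
          rw [i1, i2, abs_of_pos hh]
      _ = _ := by
          rw [Finset.sum_const, Nat.card_Ico, nsmul_eq_mul, Nat.cast_sub hab]; ring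
  have hfrac : ∀ {p p' : ℕ}, p' / 2 = p → |(p' : ℝ) * h - (2 * p : ℕ) * h| ≤ h := by
    intro p p' hp
    obtain rfl | rfl : p' = 2 * p ∨ p' = 2 * p + 1 := by omega
    · simpa using hh.le
    · have : ((2 * p + 1 : ℕ) : ℝ) * h - (2 * p : ℕ) * h = h := by push_cast; ring
      rw [this, abs_of_pos hh]
  have h2 : ‖(f (a' * h) - f ((2 * a : ℕ) * h)) (g (b' * h) - g (a' * h))‖ ≤
      Kf * Kg * (h ^ l * (((b' : ℝ) - a') * h) ^ c) := by
    refine (bil _ _ _ _).trans ?_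
    have : |(b' : ℝ) * h - a' * h| = ((b' : ℝ) - a') * h := by
      rw [← sub_mul, abs_of_nonneg]
      have : (a' : ℝ) ≤ b' := by exact_mod_cast hab'
      exact mul_nonneg (by linarith) hh.le
    rw [this]
    have h0 : 0 ≤ ((b' : ℝ) - a') * h := this ▸ abs_nonneg _
    gcongr
    exact hfrac ha
  have h3 : ‖(f ((2 * b : ℕ) * h) - f ((2 * a : ℕ) * h)) (g (b' * h) - g ((2 * b : ℕ) * h))‖ ≤
      Kf * Kg * ((2 * ((b : ℝ) - a) * h) ^ l * h ^ c) := by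
    refine (bil _ _ _ _).trans ?_
    have : |((2 * b : ℕ) : ℝ) * h - (2 * a : ℕ) * h| = 2 * ((b : ℝ) - a) * h := by
      rw [← sub_mul, abs_of_nonneg]
      · push_cast; ring
      · have : (a : ℝ) ≤ b := by exact_mod_cast hab
        push_cast
        exact mul_nonneg (by linarith) hh.le
    rw [this]
    have h0 : 0 ≤ 2 * ((b : ℝ) - a) * h := this ▸ abs_nonneg _
    gcongr
    exact hfrac hb
  rw [key]
  calc _ ≤ _ := (norm_add_le _ _).trans (add_le_add_left (norm_sub_le _ _) _)
    _ ≤ _ := add_le_add (add_le_add hsum h2) h3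
    _ = _ := by ring

end Dyadic

/-! ### Existence of the Young integral -/

section Sewing

variable {F W : Type*} [NormedAddCommGroup F] [NormedSpace ℝ F] [NormedAddCommGroup W]
  [NormedSpace ℝ W] {f : ℝ → F →L[ℝ] W} {g : ℝ → F} {l c Kf Kg T : ℝ}

/-- The index of the last point of the grid `(T / 2 ^ m) ℕ` up to `t`. -/
def gridIndex (T : ℝ) (m : ℕ) (t : ℝ) : ℕ := ⌊t / (T / 2 ^ m)⌋₊

theorem gridIndex_succ_div_two (T : ℝ) (m : ℕ) (t : ℝ) :
    gridIndex T (m + 1) t / 2 = gridIndex T m t := by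
  rw [gridIndex, gridIndex, ← Nat.floor_div_ofNat]
  congr 1
  rw [pow_succ, div_div_eq_mul_div, div_div_eq_mul_div]
  ring

theorem gridIndex_mono (hT : 0 < T) (m : ℕ) {s t : ℝ} (hst : s ≤ t) :
    gridIndex T m s ≤ gridIndex T m t := by
  unfold gridIndex; gcongr

theorem gridIndex_mul_le (hT : 0 < T) (m : ℕ) {t : ℝ} (ht : 0 ≤ t) :
    gridIndex T m t * (T / 2 ^ m) ≤ t := by
  have h : 0 < T / 2 ^ m := by positivity
  rw [← le_div_iff₀ h]
  exact Nat.floor_le (by positivity)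

theorem lt_gridIndex_mul_add (hT : 0 < T) (m : ℕ) (t : ℝ) :
    t < gridIndex T m t * (T / 2 ^ m) + T / 2 ^ m := by
  have h : 0 < T / 2 ^ m := by positivity
  have := Nat.lt_floor_add_one (t / (T / 2 ^ m))
  rw [div_lt_iff₀ h] at this
  unfold gridIndex
  linarith

theorem tendsto_gridIndex_mul (hT : 0 < T) {t : ℝ} (ht : 0 ≤ t) :
    Filter.Tendsto (fun m => gridIndex T m t * (T / 2 ^ m)) Filter.atTop (𝓝 t) := by
  have h0 : Filter.Tendsto (fun m : ℕ => T / 2 ^ m) Filter.atTop (𝓝 0) := by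
    have := (tendsto_pow_atTop_nhds_zero_of_lt_one (r := (1 / 2 : ℝ)) (by norm_num)
      (by norm_num)).const_mul T
    simpa [div_eq_mul_inv] using this
  refine tendsto_of_tendsto_of_tendsto_of_le_of_le (g := fun m => t - T / 2 ^ m) (h := fun _ => t)
    ?_ tendsto_const_nhds (fun m => ?_) (fun m => gridIndex_mul_le hT m ht)
  · simpa using tendsto_const_nhds.sub h0
  · have := lt_gridIndex_mul_add hT m t
    simp only; linarith

/-- The defects at consecutive dyadic levels above a level `n` whose mesh is comparable to `t - s`
differ geometrically little. -/
theorem dist_gridDefect_le (hl : 0 < l) (hc : 0 < c) (hKf : 0 ≤ Kf)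
    (hKg : 0 ≤ Kg) (hf : ∀ s t, ‖f t - f s‖ ≤ Kf * |t - s| ^ l)
    (hg : ∀ s t, ‖g t - g s‖ ≤ Kg * |t - s| ^ c) (hT : 0 < T) {s t : ℝ} (hs : 0 ≤ s)
    (hst : s ≤ t) {n : ℕ} (hn : t - s ≤ T / 2 ^ n) (k : ℕ) :
    dist (gridDefect f g (T / 2 ^ (n + k)) (gridIndex T (n + k) s) (gridIndex T (n + k) t))
      (gridDefect f g (T / 2 ^ (n + (k + 1))) (gridIndex T (n + (k + 1)) s)
        (gridIndex T (n + (k + 1)) t)) ≤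
      Kf * Kg * ((2 + 2 ^ c + 2 ^ l) * (T / 2 ^ n) ^ (l + c)) *
        ((2 : ℝ)⁻¹ ^ min (l + c - 1) (min l c)) ^ k := by
  set H := T / 2 ^ n with hH
  have hHpos : 0 < H := by positivity
  set q : ℝ := (2 : ℝ)⁻¹ ^ k with hq
  have hqpos : 0 < q := by positivity
  have hq1 : q ≤ 1 := pow_le_one₀ (by norm_num) (by norm_num)
  set ε := min (l + c - 1) (min l c) with hε
  have hρ : ((2 : ℝ)⁻¹ ^ ε) ^ k = q ^ ε := by
    rw [hq, ← Real.rpow_natCast, ← Real.rpow_mul (by norm_num), mul_comm,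
      Real.rpow_mul (by norm_num), Real.rpow_natCast]
  have hm : T / 2 ^ (n + k) = H * q := by
    rw [hH, hq, pow_add, inv_pow]; field_simp
  have hm1 : T / 2 ^ (n + (k + 1)) = H * q / 2 := by
    rw [← hm, ← add_assoc, pow_succ]; field_simp
  set a := gridIndex T (n + k) s
  set b := gridIndex T (n + k) t
  set a' := gridIndex T (n + (k + 1)) s
  set b' := gridIndex T (n + (k + 1)) t
  have hab : a ≤ b := gridIndex_mono hT _ hst
  have hab' : a' ≤ b' := gridIndex_mono hT _ hst
  have hstep := norm_gridDefect_sub_le hl hc hKf hKg hf hg (h := H * q / 2) (by positivity)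
    hab hab' (gridIndex_succ_div_two T (n + k) s) (gridIndex_succ_div_two T (n + k) t)
  -- the grid points below `s` and `t` are at distance at most `2 H`, on both levels
  have width : ((b : ℝ) - a) * (H * q) ≤ 2 * H := by
    have h1 := gridIndex_mul_le hT (n + k) (hs.trans hst)
    have h2 := lt_gridIndex_mul_add hT (n + k) s
    rw [hm] at h1 h2
    have : H * q ≤ H := mul_le_of_le_one_right hHpos.le hq1
    have e : ((b : ℝ) - a) * (H * q) = b * (H * q) - a * (H * q) := by ring
    rw [e]; linarith
  have width' : ((b' : ℝ) - a') * (H * q / 2) ≤ 2 * H := by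
    have h1 := gridIndex_mul_le hT (n + (k + 1)) (hs.trans hst)
    have h2 := lt_gridIndex_mul_add hT (n + (k + 1)) s
    rw [hm1] at h1 h2
    have : H * q ≤ H := mul_le_of_le_one_right hHpos.le hq1
    have e : ((b' : ℝ) - a') * (H * q / 2) = b' * (H * q / 2) - a' * (H * q / 2) := by ring
    rw [e]; linarith
  have hba : (0 : ℝ) ≤ (b : ℝ) - a := sub_nonneg.2 (by exact_mod_cast hab)
  have hba' : (0 : ℝ) ≤ (b' : ℝ) - a' := sub_nonneg.2 (by exact_mod_cast hab')
  rw [dist_comm, dist_eq_norm, hm, hm1]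
  rw [show 2 * (H * q / 2) = H * q by ring] at hstep
  refine hstep.trans ?_
  rw [hρ, mul_assoc (Kf * Kg)]
  refine mul_le_mul_of_nonneg_left ?_ (mul_nonneg hKf hKg)
  have half : H * q / 2 ≤ H * q := by linarith [mul_pos hHpos hqpos]
  -- each of the three terms is `H ^ (l + c)` times a positive power of `q`
  have e1 : ((b : ℝ) - a) * ((H * q / 2) ^ l * (H * q / 2) ^ c) ≤ 2 * H ^ (l + c) * q ^ ε := by
    calc _ ≤ ((b : ℝ) - a) * ((H * q) ^ l * (H * q) ^ c) := by gcongr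
      _ = (((b : ℝ) - a) * (H * q)) * (H * q) ^ (l + c - 1) := by
        rw [← Real.rpow_add (by positivity), Real.rpow_sub_one (by positivity)]
        field_simp
      _ ≤ 2 * H * (H * q) ^ (l + c - 1) := by gcongr
      _ = 2 * H ^ (l + c) * q ^ (l + c - 1) := by
        rw [Real.mul_rpow hHpos.le hqpos.le, Real.rpow_sub_one hHpos.ne' (l + c)]
        field_simp
      _ ≤ _ := by
        refine mul_le_mul_of_nonneg_left ?_ (by positivity)
        exact Real.rpow_le_rpow_of_exponent_ge hqpos hq1 (min_le_left _ _)
  have e2 : (H * q / 2) ^ l * (((b' : ℝ) - a') * (H * q / 2)) ^ c ≤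
      2 ^ c * H ^ (l + c) * q ^ ε := by
    calc _ ≤ (H * q) ^ l * (2 * H) ^ c := by gcongr
      _ = 2 ^ c * H ^ (l + c) * q ^ l := by
        rw [Real.mul_rpow hHpos.le hqpos.le, Real.mul_rpow (by norm_num) hHpos.le,
          Real.rpow_add hHpos]
        ring
      _ ≤ _ := by
        refine mul_le_mul_of_nonneg_left ?_ (by positivity)
        exact Real.rpow_le_rpow_of_exponent_ge hqpos hq1
          ((min_le_right _ _).trans (min_le_left _ _))
  have e3 : (2 * ((b : ℝ) - a) * (H * q / 2)) ^ l * (H * q / 2) ^ c ≤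
      2 ^ l * H ^ (l + c) * q ^ ε := by
    calc _ ≤ (2 * H) ^ l * (H * q) ^ c := by
          have : 2 * ((b : ℝ) - a) * (H * q / 2) ≤ 2 * H := by linarith
          gcongr
      _ = 2 ^ l * H ^ (l + c) * q ^ c := by
        rw [Real.mul_rpow hHpos.le hqpos.le, Real.mul_rpow (by norm_num) hHpos.le,
          Real.rpow_add hHpos]
        ring
      _ ≤ _ := by
        refine mul_le_mul_of_nonneg_left ?_ (by positivity)
        exact Real.rpow_le_rpow_of_exponent_ge hqpos hq1
          ((min_le_right _ _).trans (min_le_right _ _))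
  calc _ ≤ _ := add_le_add (add_le_add e1 e2) e3
    _ = _ := by ring

/-- The constant in the Young–Loève estimate for exponents `l` and `c`. -/
def youngConst (l c : ℝ) : ℝ :=
  (2 + 2 ^ c + 2 ^ l) * 2 ^ (l + c) / (1 - (2 : ℝ)⁻¹ ^ min (l + c - 1) (min l c)) + 1

theorem half_rpow_lt_one (hl : 0 < l) (hc : 0 < c) (hlc : 1 < l + c) :
    (2 : ℝ)⁻¹ ^ min (l + c - 1) (min l c) < 1 :=
  Real.rpow_lt_one (by norm_num) (by norm_num)
    (lt_min (by linarith) (lt_min hl hc))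

theorem youngConst_nonneg (hl : 0 < l) (hc : 0 < c) (hlc : 1 < l + c) : 0 ≤ youngConst l c := by
  have := half_rpow_lt_one hl hc hlc
  have : 0 < 1 - (2 : ℝ)⁻¹ ^ min (l + c - 1) (min l c) := by linarith
  unfold youngConst
  positivity

theorem continuous_of_norm_sub_le_rpow {Y : Type*} [NormedAddCommGroup Y] {p : ℝ → Y} {K e : ℝ}
    (he : 0 < e) (hp : ∀ s t, ‖p t - p s‖ ≤ K * |t - s| ^ e) : Continuous p := by
  refine continuous_iff_continuousAt.2 fun s => ?_
  refine tendsto_iff_norm_sub_tendsto_zero.2 (squeeze_zero (fun _ => norm_nonneg _)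
    (fun t => hp s t) ?_)
  have : Continuous fun t : ℝ => K * |t - s| ^ e :=
    continuous_const.mul ((by fun_prop : Continuous fun t : ℝ => |t - s|).rpow_const
      fun _ => Or.inr he.le)
  simpa [Real.zero_rpow he.ne'] using this.tendsto s

/-- Existence of the Young integral on `[0, T]`, with the Young–Loève estimate: the dyadic Riemann
sums converge, and comparing them from the level whose mesh is comparable to `t - s` onwards gives
the local estimate. -/
theorem exists_young_integral [CompleteSpace W] (hl : 0 < l) (hc : 0 < c) (hlc : 1 < l + c)
    (hKf : 0 ≤ Kf) (hKg : 0 ≤ Kg) (hf : ∀ s t, ‖f t - f s‖ ≤ Kf * |t - s| ^ l)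
    (hg : ∀ s t, ‖g t - g s‖ ≤ Kg * |t - s| ^ c) (hT : 0 < T) :
    ∃ I : ℝ → W, I 0 = 0 ∧ ∀ s ∈ Icc 0 T, ∀ t ∈ Icc 0 T,
      ‖I t - I s - f s (g t - g s)‖ ≤ youngConst l c * (Kf * Kg) * |t - s| ^ (l + c) := by
  have cf : Continuous f := continuous_of_norm_sub_le_rpow hl hf
  have cg : Continuous g := continuous_of_norm_sub_le_rpow hc hg
  set ρ := (2 : ℝ)⁻¹ ^ min (l + c - 1) (min l c) with hρ
  have hρ1 : ρ < 1 := half_rpow_lt_one hl hc hlc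
  set S : ℝ → ℕ → W := fun t m => gridSum f g (T / 2 ^ m) (gridIndex T m t) with hS
  have germ : ∀ {s t : ℝ}, 0 ≤ s → 0 ≤ t → Filter.Tendsto (fun m : ℕ =>
      f (gridIndex T m s * (T / 2 ^ m))
        (g (gridIndex T m t * (T / 2 ^ m)) - g (gridIndex T m s * (T / 2 ^ m))))
      Filter.atTop (𝓝 (f s (g t - g s))) := by
    intro s t hs ht
    have h1 := tendsto_gridIndex_mul hT hs
    have h2 := tendsto_gridIndex_mul hT ht
    have h3 := (cf.tendsto s).comp h1
    have h4 := ((cg.tendsto t).comp h2).sub ((cg.tendsto s).comp h1)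
    exact (isBoundedBilinearMap_apply.continuous.tendsto (f s, g t - g s)).comp (h3.prodMk_nhds h4)
  have S0 : ∀ m, S 0 m = 0 := fun m => by simp [hS, gridIndex, gridSum]
  have conv : ∀ t ∈ Icc 0 T, ∃ w, Filter.Tendsto (S t) Filter.atTop (𝓝 w) := by
    intro t ht
    have hcau := cauchySeq_of_le_geometric _ _ hρ1
      (dist_gridDefect_le hl hc hKf hKg hf hg hT le_rfl ht.1 (n := 0) (by simpa using ht.2))
    obtain ⟨w, hw⟩ := cauchySeq_tendsto_of_complete hcau
    refine ⟨w + f 0 (g t - g 0), ?_⟩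
    refine (hw.add (germ le_rfl ht.1)).congr fun m => ?_
    have := S0 m
    simp only [hS] at this ⊢
    simp [gridDefect, this]
  choose! I hI using conv
  have I0 : I 0 = 0 := by
    refine tendsto_nhds_unique (hI 0 ⟨le_rfl, hT.le⟩) ?_
    simp [show S 0 = fun _ => 0 from funext S0]
  have fwd : ∀ s ∈ Icc 0 T, ∀ t ∈ Icc 0 T, s ≤ t → ‖I t - I s - f s (g t - g s)‖ ≤
      (youngConst l c - 1) * (Kf * Kg) * |t - s| ^ (l + c) := by
    intro s hs t ht hst
    rcases hst.eq_or_lt with rfl | hlt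
    · simp [Real.zero_rpow (by linarith : l + c ≠ 0)]
    have hd : 0 < t - s := by linarith
    obtain ⟨n, hn1, hn2⟩ := exists_nat_pow_near_of_lt_one (x := (t - s) / T) (y := (1 / 2 : ℝ))
      (by positivity) ((div_le_one hT).2 (by linarith [hs.1, ht.2])) (by norm_num) (by norm_num)
    have hn : t - s ≤ T / 2 ^ n := by
      rw [div_le_iff₀ hT] at hn2
      calc _ ≤ _ := hn2
        _ = _ := by rw [one_div, inv_pow]; field_simp
    have hn' : T / 2 ^ n ≤ 2 * (t - s) := by
      rw [lt_div_iff₀ hT] at hn1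
      have : T / 2 ^ n = 2 * ((1 / 2) ^ (n + 1) * T) := by
        rw [one_div, inv_pow, pow_succ]; field_simp
      linarith
    have hlim : Filter.Tendsto (fun k => gridDefect f g (T / 2 ^ (n + k)) (gridIndex T (n + k) s)
        (gridIndex T (n + k) t)) Filter.atTop (𝓝 (I t - I s - f s (g t - g s))) := by
      have := (((hI t ht).sub (hI s hs)).sub (germ hs.1 ht.1)).comp
        (Filter.tendsto_add_atTop_nat n)
      refine this.congr fun k => ?_
      simp only [Function.comp_apply, hS, gridDefect, add_comm n k]
    have hdist := dist_le_of_le_geometric_of_tendsto₀ _ _ hρ1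
      (dist_gridDefect_le hl hc hKf hKg hf hg hT hs.1 hst hn) hlim
    -- at the level `n`, the two points are in the same or in neighbouring grid intervals
    have hzero : gridDefect f g (T / 2 ^ (n + 0)) (gridIndex T (n + 0) s)
        (gridIndex T (n + 0) t) = 0 := by
      have h1 := gridIndex_mono hT (n + 0) hst
      have h2 : gridIndex T (n + 0) t ≤ gridIndex T (n + 0) s + 1 := by
        have hpos : 0 < T / 2 ^ n := by positivity
        have hle : t / (T / 2 ^ n) ≤ s / (T / 2 ^ n) + 1 := by
          rw [div_add_one hpos.ne']; gcongr; linarith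
        calc _ ≤ ⌊s / (T / 2 ^ n) + 1⌋₊ := Nat.floor_mono hle
          _ = _ := Nat.floor_add_one (div_nonneg hs.1 hpos.le)
      obtain h | h : gridIndex T (n + 0) t = gridIndex T (n + 0) s ∨
        gridIndex T (n + 0) t = gridIndex T (n + 0) s + 1 := by omega
      · rw [h, gridDefect_self]
      · rw [h, gridDefect_succ]
    rw [hzero, dist_zero_left] at hdist
    refine hdist.trans ?_
    have hpos : 0 < 1 - ρ := by linarith
    have : (T / 2 ^ n) ^ (l + c) ≤ 2 ^ (l + c) * |t - s| ^ (l + c) := by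
      rw [abs_of_pos hd, ← Real.mul_rpow (by norm_num) hd.le]
      gcongr
    calc _ ≤ Kf * Kg * ((2 + 2 ^ c + 2 ^ l) * (2 ^ (l + c) * |t - s| ^ (l + c))) / (1 - ρ) := by
          gcongr
      _ = _ := by rw [youngConst]; ring
  refine ⟨I, I0, fun s hs t ht => ?_⟩
  have hpos : 0 ≤ Kf * Kg * |t - s| ^ (l + c) := by positivity
  rcases le_total s t with hst | hst
  · refine (fwd s hs t ht hst).trans ?_
    nlinarith
  · have h1 := fwd t ht s hs hst
    have h2 : ‖(f t - f s) (g t - g s)‖ ≤ Kf * Kg * |t - s| ^ (l + c) := by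
      calc _ ≤ ‖f t - f s‖ * ‖g t - g s‖ := ContinuousLinearMap.le_opNorm _ _
        _ ≤ (Kf * |t - s| ^ l) * (Kg * |t - s| ^ c) := by gcongr <;> [exact hf _ _; exact hg _ _]
        _ = _ := by rw [Real.rpow_add_of_nonneg (abs_nonneg _) hl.le hc.le]; ring
    have e : I t - I s - f s (g t - g s) =
        -(I s - I t - f t (g s - g t)) + (f t - f s) (g t - g s) := by
      simp only [map_sub, sub_apply]; abel
    rw [e]
    refine (norm_add_le _ _).trans ?_
    rw [norm_neg]
    rw [abs_sub_comm] at h1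
    linarith

end Sewing

/-! ### The Banach space of Hölder functions -/

section Holder

variable {α : ℝ≥0} {a c b : ℝ} {V : Type*} [NormedAddCommGroup V]

theorem mul_rpow_le_mul_rpow {K x y : ℝ} (hK : 0 ≤ K) (h : |x| ≤ |y|) :
    K * |x| ^ (α : ℝ) ≤ K * |y| ^ (α : ℝ) :=
  mul_le_mul_of_nonneg_left (Real.rpow_le_rpow (abs_nonneg _) h α.coe_nonneg) hK

theorem holderWith_iff_norm_sub_le {C : ℝ≥0} {g : Icc a b → V} :
    HolderWith C α g ↔ ∀ s t, ‖g t - g s‖ ≤ C * |(t : ℝ) - s| ^ (α : ℝ) := by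
  constructor
  · intro h s t
    have := h.dist_le t s
    rwa [dist_eq_norm, Subtype.dist_eq, Real.dist_eq] at this
  · intro h s t
    have h1 := h t s
    have : ENNReal.ofReal (dist (g s) (g t)) ≤ ENNReal.ofReal (C * dist s t ^ (α : ℝ)) := by
      rw [dist_eq_norm, Subtype.dist_eq, Real.dist_eq]
      exact ENNReal.ofReal_le_ofReal h1
    rwa [ENNReal.ofReal_mul C.coe_nonneg, ← ENNReal.ofReal_rpow_of_nonneg dist_nonneg
      α.coe_nonneg, ← edist_dist, ← edist_dist, ENNReal.ofReal_coe_nnreal] at this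

theorem holderWith_of_norm_sub_le {C : ℝ} (hC : 0 ≤ C) {g : Icc a b → V}
    (h : ∀ s t, ‖g t - g s‖ ≤ C * |(t : ℝ) - s| ^ (α : ℝ)) : HolderWith ⟨C, hC⟩ α g :=
  holderWith_iff_norm_sub_le.2 h

variable [NormedSpace ℝ V]

namespace HolderZero

@[ext] theorem ext {g g' : HolderZero α a c b V} (h : ∀ t, g t = g' t) : g = g' :=
  Subtype.ext (funext h)

@[simp] theorem add_apply (g g' : HolderZero α a c b V) (t : Icc a b) :
    (g + g') t = g t + g' t := rfl

@[simp] theorem sub_apply (g g' : HolderZero α a c b V) (t : Icc a b) :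
    (g - g') t = g t - g' t := rfl

@[simp] theorem smul_apply (r : ℝ) (g : HolderZero α a c b V) (t : Icc a b) :
    (r • g) t = r • g t := rfl

theorem norm_sub_apply_le (g : HolderZero α a c b V) (s t : Icc a b) :
    ‖g t - g s‖ ≤ ‖g‖ * |(t : ℝ) - s| ^ (α : ℝ) := by
  rw [norm_def]
  exact holderWith_iff_norm_sub_le.1 g.2.1.holderWith s t

theorem norm_le_of_norm_sub_le {g : HolderZero α a c b V} {C : ℝ} (hC : 0 ≤ C)
    (h : ∀ s t, ‖g t - g s‖ ≤ C * |(t : ℝ) - s| ^ (α : ℝ)) : ‖g‖ ≤ C := by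
  rw [norm_def]
  have := (holderWith_of_norm_sub_le hC h).nnholderNorm_le
  exact_mod_cast this

theorem norm_apply_le (g : HolderZero α a c b V) (t : Icc a b) :
    ‖g t‖ ≤ ‖g‖ * (b - a) ^ (α : ℝ) := by
  have hab : a ≤ b := t.2.1.trans t.2.2
  have h := g.norm_sub_apply_le ⟨a, le_rfl, hab⟩ t
  rw [g.2.2 ⟨a, le_rfl, hab⟩ (le_max_left _ _), sub_zero] at h
  refine h.trans ?_
  have h1 : |(t : ℝ) - a| ≤ b - a := by
    rw [abs_of_nonneg (by linarith [t.2.1])]; linarith [t.2.2]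
  gcongr

/-- Evaluation at a time as a bounded linear map. -/
def evalCLM (t : Icc a b) : HolderZero α a c b V →L[ℝ] V :=
  LinearMap.mkContinuous
    { toFun := fun g => g t
      map_add' := fun _ _ => rfl
      map_smul' := fun _ _ => rfl } ((b - a) ^ (α : ℝ)) fun g => by
    rw [mul_comm]; exact g.norm_apply_le t

@[simp] theorem evalCLM_apply (t : Icc a b) (g : HolderZero α a c b V) : evalCLM t g = g t := rfl

instance [CompleteSpace V] : CompleteSpace (HolderZero α a c b V) := by
  refine Metric.complete_of_cauchySeq_tendsto fun u hu => ?_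
  have hpt : ∀ t : Icc a b, ∃ v, Filter.Tendsto (fun n => u n t) Filter.atTop (𝓝 v) := fun t =>
    cauchySeq_tendsto_of_complete
      (hu.map (evalCLM (α := α) (c := c) (V := V) t).uniformContinuous)
  choose g hg using hpt
  have key : ∀ ε > 0, ∃ N, ∀ n ≥ N, ∀ s t : Icc a b,
      ‖(g t - u n t) - (g s - u n s)‖ ≤ ε * |(t : ℝ) - s| ^ (α : ℝ) := by
    intro ε hε
    obtain ⟨N, hN⟩ := Metric.cauchySeq_iff.1 hu ε hε
    refine ⟨N, fun n hn s t => ?_⟩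
    have hlim : Filter.Tendsto (fun m => ‖(u m t - u n t) - (u m s - u n s)‖) Filter.atTop
        (𝓝 ‖(g t - u n t) - (g s - u n s)‖) :=
      (((hg t).sub_const _).sub ((hg s).sub_const _)).norm
    refine le_of_tendsto hlim (Filter.eventually_atTop.2 ⟨N, fun m hm => ?_⟩)
    refine ((u m - u n).norm_sub_apply_le s t).trans ?_
    have := (hN m hm n hn).le
    rw [dist_eq_norm] at this
    gcongr
  obtain ⟨N, hN⟩ := key 1 one_pos
  have hmem : MemHolder α g := by
    have h1 := (holderWith_of_norm_sub_le (g := fun t => g t - u N t) zero_le_one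
      (hN N le_rfl)).memHolder
    have h2 := h1.add (u N).2.1
    have e : g = (fun t => g t - u N t) + (u N).1 := by
      funext t; exact (sub_add_cancel _ _).symm
    rw [e]; exact h2
  have hvan : ∀ t : Icc a b, (t : ℝ) ≤ max a c → g t = 0 := fun t ht => by
    refine tendsto_nhds_unique (hg t) ?_
    simp only [fun n => (u n).2.2 t ht]
    exact tendsto_const_nhds
  set G : HolderZero α a c b V := ⟨g, hmem, hvan⟩
  refine ⟨G, Metric.tendsto_atTop.2 fun ε hε => ?_⟩
  obtain ⟨N, hN⟩ := key (ε / 2) (by positivity)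
  refine ⟨N, fun n hn => ?_⟩
  rw [dist_comm, dist_eq_norm]
  exact (norm_le_of_norm_sub_le (by positivity) (hN n hn)).trans_lt (by linarith)

/-- The time `t ∧ τ`, for `τ` below `a` replaced by `a`. -/
def stopTime (τ : ℝ) (t : Icc a b) : Icc a b :=
  ⟨max a (min t τ), le_max_left _ _, max_le (t.2.1.trans t.2.2) ((min_le_left _ _).trans t.2.2)⟩

theorem abs_stopTime_sub_le (τ : ℝ) (s t : Icc a b) :
    |(stopTime τ t : ℝ) - stopTime τ s| ≤ |(t : ℝ) - s| := by
  refine (abs_max_sub_max_le_max _ _ _ _).trans ?_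
  rw [sub_self, abs_zero, max_eq_right (abs_nonneg _)]
  refine (abs_min_sub_min_le_max _ _ _ _).trans ?_
  rw [sub_self, abs_zero, max_eq_left (abs_nonneg _)]

theorem norm_sub_apply_stopTime_le (g : HolderZero α a c b V) (τ : ℝ) (s t : Icc a b) :
    ‖g (stopTime τ t) - g (stopTime τ s)‖ ≤ ‖g‖ * |(t : ℝ) - s| ^ (α : ℝ) :=
  (g.norm_sub_apply_le _ _).trans
    (mul_rpow_le_mul_rpow (norm_nonneg g) (abs_stopTime_sub_le τ s t))

/-- The operator which stops a path at time `τ`. -/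
def stopAt (τ : ℝ) : HolderZero α a c b V →L[ℝ] HolderZero α a c b V :=
  LinearMap.mkContinuous
    { toFun := fun g => ⟨fun t => g (stopTime τ t),
        (holderWith_of_norm_sub_le (norm_nonneg g) (g.norm_sub_apply_stopTime_le τ)).memHolder,
        fun t ht => g.2.2 _ (max_le (le_max_left _ _) ((min_le_left _ _).trans ht))⟩
      map_add' := fun _ _ => rfl
      map_smul' := fun _ _ => rfl } 1 fun g => by
    rw [one_mul]
    exact norm_le_of_norm_sub_le (norm_nonneg g) (g.norm_sub_apply_stopTime_le τ)

theorem stopAt_apply (τ : ℝ) (g : HolderZero α a c b V) (t : Icc a b) :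
    stopAt τ g t = g (stopTime τ t) := rfl

theorem norm_stopAt_le (τ : ℝ) (g : HolderZero α a c b V) : ‖stopAt τ g‖ ≤ ‖g‖ :=
  norm_le_of_norm_sub_le (norm_nonneg g) (g.norm_sub_apply_stopTime_le τ)

theorem stopTime_of_le {τ : ℝ} {t : Icc a b} (h : (t : ℝ) ≤ τ) : stopTime τ t = t := by
  apply Subtype.ext
  simp only [stopTime, min_eq_left h, max_eq_right t.2.1]

theorem stopTime_le {τ : ℝ} (hτ : a ≤ τ) (t : Icc a b) : (stopTime τ t : ℝ) ≤ τ :=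
  max_le hτ (min_le_right _ _)

theorem stopAt_eq_stop_iff {τ : ℝ} (hτ : a ≤ τ) {g g' : HolderZero α a c b V} :
    stopAt τ g = stopAt τ g' ↔ ∀ t : Icc a b, (t : ℝ) ≤ τ → g t = g' t := by
  constructor
  · intro h t ht
    have h1 : stopAt τ g t = stopAt τ g' t := by rw [h]
    rwa [stopAt_apply, stopAt_apply, stopTime_of_le ht] at h1
  · intro h
    ext t
    exact h _ (stopTime_le hτ t)

theorem stopAt_eq_zero_iff {τ : ℝ} (hτ : a ≤ τ) {g : HolderZero α a c b V} :
    stopAt τ g = 0 ↔ ∀ t : Icc a b, (t : ℝ) ≤ τ → g t = 0 := by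
  rw [← map_zero (stopAt (α := α) (a := a) (c := c) (b := b) (V := V) τ), stopAt_eq_stop_iff hτ]
  rfl

theorem stopTime_stopTime {σ τ : ℝ} (h : σ ≤ τ) (t : Icc a b) :
    stopTime τ (stopTime σ t) = stopTime σ t ∧ stopTime σ (stopTime τ t) = stopTime σ t := by
  constructor <;> apply Subtype.ext <;> simp only [stopTime] <;> grind

theorem isStopping (ha : a ≤ 0) : IsStopping (stopAt (α := α) (a := a) (c := 0) (b := b) (V := V)) b
    where
  zero := by
    ext1 g
    refine (stopAt_eq_zero_iff ha).2 fun t ht => g.2.2 t (ht.trans (le_max_right _ _))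
  final := by
    ext1 g
    ext t
    rw [stopAt_apply, stopTime_of_le t.2.2]; rfl
  norm_le := norm_stopAt_le
  comp_left σ τ g _ h := by
    ext t
    exact congrArg g.1 (stopTime_stopTime h t).1
  comp_right σ τ g _ h := by
    ext t
    exact congrArg g.1 (stopTime_stopTime h t).2

end HolderZero

end Holder

/-! ### Young integrals of Hölder functions -/

section Young

variable {T : ℝ} {F W : Type*} [NormedAddCommGroup F] [NormedSpace ℝ F]
  [NormedAddCommGroup W] [NormedSpace ℝ W]

/-- A function which is Hölder continuous with exponents greater than one is constant. -/
theorem eq_of_norm_sub_le_rpow {W : Type*} [NormedAddCommGroup W] {p : ℝ → W}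
    {τ C₁ C₂ μ₁ μ₂ : ℝ} (h1 : 1 < μ₁) (h2 : 1 < μ₂)
    (hτ : 0 ≤ τ) (hp : ∀ s ∈ Icc 0 τ, ∀ t ∈ Icc 0 τ,
      ‖p t - p s‖ ≤ C₁ * |t - s| ^ μ₁ + C₂ * |t - s| ^ μ₂) : p τ = p 0 := by
  -- cutting `[0, τ]` into `n + 1` equal pieces gains a factor `(n + 1) ^ (1 - μ)`
  have bound : ∀ n : ℕ, ‖p τ - p 0‖ ≤
      C₁ * τ ^ μ₁ * ((n + 1 : ℕ) : ℝ) ^ (-(μ₁ - 1)) +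
        C₂ * τ ^ μ₂ * ((n + 1 : ℕ) : ℝ) ^ (-(μ₂ - 1)) := by
    intro n
    set N : ℝ := ((n + 1 : ℕ) : ℝ) with hN
    have hNpos : 0 < N := by positivity
    have tele : p τ - p 0 =
        ∑ j ∈ Finset.range (n + 1), (p ((j + 1 : ℕ) * (τ / N)) - p ((j : ℕ) * (τ / N))) := by
      rw [Finset.sum_range_sub (fun j : ℕ => p (j * (τ / N)))]
      congr 2
      · rw [← hN]; field_simp
      · simp
    have term : ∀ j ∈ Finset.range (n + 1),
        ‖p ((j + 1 : ℕ) * (τ / N)) - p ((j : ℕ) * (τ / N))‖ ≤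
          C₁ * (τ / N) ^ μ₁ + C₂ * (τ / N) ^ μ₂ := by
      intro j hj
      have hmem : ∀ i : ℕ, i ≤ n + 1 → (i : ℝ) * (τ / N) ∈ Icc 0 τ := by
        intro i hi
        refine ⟨by positivity, ?_⟩
        have : (i : ℝ) ≤ N := by rw [hN]; exact_mod_cast hi
        rw [mul_div_assoc', div_le_iff₀ hNpos, mul_comm]
        gcongr
      have hj' := Finset.mem_range.1 hj
      have h := hp _ (hmem j (by omega)) _ (hmem (j + 1) (by omega))
      have e : ((j + 1 : ℕ) : ℝ) * (τ / N) - j * (τ / N) = τ / N := by push_cast; ring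
      rwa [e, abs_of_nonneg (by positivity)] at h
    rw [tele]
    refine (norm_sum_le_of_le _ term).trans (le_of_eq ?_)
    rw [Finset.sum_const, Finset.card_range, nsmul_eq_mul, ← hN, Real.div_rpow hτ hNpos.le,
      Real.div_rpow hτ hNpos.le, neg_sub, neg_sub, Real.rpow_sub hNpos, Real.rpow_sub hNpos,
      Real.rpow_one]
    field_simp
  have lim : ∀ {μ : ℝ}, 1 < μ → Filter.Tendsto (fun n : ℕ => ((n + 1 : ℕ) : ℝ) ^ (-(μ - 1)))
      Filter.atTop (𝓝 0) := fun {μ} hμ =>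
    (tendsto_rpow_neg_atTop (by linarith)).comp
      (tendsto_natCast_atTop_atTop.comp (Filter.tendsto_add_atTop_nat 1))
  have := ge_of_tendsto' (((lim h1).const_mul (C₁ * τ ^ μ₁)).add
    ((lim h2).const_mul (C₂ * τ ^ μ₂))) bound
  simp only [mul_zero, add_zero] at this
  exact sub_eq_zero.1 (norm_eq_zero.1 (le_antisymm this (norm_nonneg _)))

variable {φ ψ : Icc 0 T → F →L[ℝ] W} {g : Icc 0 T → F} {I J : Icc 0 T → W}

theorem IsYoungIntegral.exists_bound (h : IsYoungIntegral φ g I) :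
    ∃ μ C : ℝ, 1 < μ ∧ ∀ s t, ‖I t - I s - φ s (g t - g s)‖ ≤ C * |(t : ℝ) - s| ^ μ := by
  obtain ⟨-, R, ⟨-, -, ⟨μ, C, hμ, hC⟩, -⟩, hR⟩ := h
  refine ⟨μ, C, hμ, fun s t => ?_⟩
  rw [hR, add_sub_cancel_left]
  exact hC s t

/-- A germ estimate with an exponent greater than one identifies a Young integral: the compensator
is its own sewing remainder. -/
theorem isYoungIntegral_of_bound (hφ : Continuous φ) (hg : Continuous g) (hI : Continuous I)
    (h0 : ∀ t : Icc 0 T, (t : ℝ) = 0 → I t = 0) {μ C : ℝ} (hμ : 1 < μ)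
    (h : ∀ s t, ‖I t - I s - φ s (g t - g s)‖ ≤ C * |(t : ℝ) - s| ^ μ) :
    IsYoungIntegral φ g I := by
  refine ⟨h0, fun s t => I t - I s - φ s (g t - g s), ⟨?_, by simp, ⟨μ, C, hμ, h⟩, ?_⟩, by simp⟩
  · have : Continuous fun p : Icc (0 : ℝ) T × Icc (0 : ℝ) T => φ p.1 (g p.2 - g p.1) :=
      isBoundedBilinearMap_apply.continuous.comp
        ((hφ.comp continuous_fst).prodMk ((hg.comp continuous_snd).sub (hg.comp continuous_fst)))
    exact ((hI.comp continuous_snd).sub (hI.comp continuous_fst)).sub this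
  · intro s u t
    simp only [map_sub, _root_.sub_apply]
    abel

/-- Uniqueness and causality of the Young integral. -/
theorem IsYoungIntegral.eq_of_le (hI : IsYoungIntegral φ g I) (hJ : IsYoungIntegral ψ g J) {τ : ℝ}
    (h : ∀ t : Icc 0 T, (t : ℝ) ≤ τ → φ t = ψ t) (t : Icc 0 T) (ht : (t : ℝ) ≤ τ) : I t = J t := by
  obtain ⟨μ₁, C₁, h1, hC1⟩ := hI.exists_bound
  obtain ⟨μ₂, C₂, h2, hC2⟩ := hJ.exists_bound
  have hT : 0 ≤ T := t.2.1.trans t.2.2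
  set p : ℝ → W := fun s => I (projIcc 0 T hT s) - J (projIcc 0 T hT s) with hp
  have key := eq_of_norm_sub_le_rpow (p := p) (C₁ := C₁) (C₂ := C₂) h1 h2 t.2.1 ?_
  · have e1 : projIcc 0 T hT t = t := projIcc_val _ _
    have e2 : I (projIcc 0 T hT 0) = 0 := hI.1 _ (by simp [projIcc, hT])
    have e3 : J (projIcc 0 T hT 0) = 0 := hJ.1 _ (by simp [projIcc, hT])
    simp only [hp, e1, e2, e3, sub_zero] at key
    exact sub_eq_zero.1 key
  · intro u hu v hv
    have hu' : u ∈ Icc 0 T := ⟨hu.1, hu.2.trans t.2.2⟩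
    have hv' : v ∈ Icc 0 T := ⟨hv.1, hv.2.trans t.2.2⟩
    simp only [hp, projIcc_of_mem hT hu', projIcc_of_mem hT hv']
    have a1 := hC1 ⟨u, hu'⟩ ⟨v, hv'⟩
    have a2 := hC2 ⟨u, hu'⟩ ⟨v, hv'⟩
    rw [h ⟨u, hu'⟩ (hu.2.trans ht)] at a1
    refine le_trans (le_of_eq ?_) ((norm_sub_le _ _).trans (add_le_add a1 a2))
    congr 1
    abel

theorem IsYoungIntegral.unique (hI : IsYoungIntegral φ g I) (hJ : IsYoungIntegral φ g J) : I = J :=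
  funext fun t => hI.eq_of_le hJ (τ := T) (fun _ _ => rfl) t t.2.2

/-- The Young integral only depends on the increments of the integrator. -/
theorem IsYoungIntegral.congr_increments (hI : IsYoungIntegral φ g I) {g' : Icc 0 T → F}
    (h : ∀ s t, g' t - g' s = g t - g s) : IsYoungIntegral φ g' I := by
  obtain ⟨h0, R, hR, hR'⟩ := hI
  refine ⟨h0, R, ?_, fun s t => by rw [h, hR']⟩
  simpa only [h] using hR

variable {lam γ : ℝ≥0}

theorem exists_youngIntegral [CompleteSpace W] (hT : 0 < T) (hlam : 0 < lam) (hγ : 0 < γ)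
    (hlg : 1 < (lam : ℝ) + γ) {Kf Kg : ℝ≥0} (hφ : HolderWith Kf lam φ) (hg : HolderWith Kg γ g) :
    ∃ I : Icc 0 T → W, (∀ t : Icc 0 T, (t : ℝ) = 0 → I t = 0) ∧
      ∀ s t, ‖I t - I s - φ s (g t - g s)‖ ≤
        youngConst lam γ * (Kf * Kg) * |(t : ℝ) - s| ^ ((lam : ℝ) + γ) := by
  have proj : ∀ s t : ℝ, |((projIcc 0 T hT.le t : Icc 0 T) : ℝ) - projIcc 0 T hT.le s| ≤ |t - s| :=
    fun s t => abs_projIcc_sub_projIcc hT.le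
  obtain ⟨I, h0, hI⟩ := exists_young_integral (f := fun t => φ (projIcc 0 T hT.le t))
    (g := fun t => g (projIcc 0 T hT.le t)) (l := lam) (c := γ) (Kf := Kf) (Kg := Kg)
    (by exact_mod_cast hlam) (by exact_mod_cast hγ) hlg Kf.2 Kg.2
    (fun s t => (holderWith_iff_norm_sub_le.1 hφ _ _).trans
      (mul_rpow_le_mul_rpow (NNReal.coe_nonneg _) (proj s t)))
    (fun s t => (holderWith_iff_norm_sub_le.1 hg _ _).trans
      (mul_rpow_le_mul_rpow (NNReal.coe_nonneg _) (proj s t))) hT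
  refine ⟨fun t => I t, fun t ht => by simp only [ht, h0], fun s t => ?_⟩
  have := hI s s.2 t t.2
  simpa only [projIcc_val] using this

/-- The increments of a Young integral inherit the Hölder exponent `γ` of the integrator. -/
theorem norm_sub_le_of_young_bound {S C Kf Kg : ℝ}
    (hC : 0 ≤ C) (hKf : 0 ≤ Kf) (hKg : 0 ≤ Kg)
    (hg : ∀ s t, ‖g t - g s‖ ≤ Kg * |(t : ℝ) - s| ^ (γ : ℝ)) {s t : Icc 0 T} (hS : ‖φ s‖ ≤ S)
    (h : ‖I t - I s - φ s (g t - g s)‖ ≤ C * (Kf * Kg) * |(t : ℝ) - s| ^ ((lam : ℝ) + γ)) :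
    ‖I t - I s‖ ≤ (S + C * T ^ (lam : ℝ) * Kf) * Kg * |(t : ℝ) - s| ^ (γ : ℝ) := by
  have h1 : ‖φ s (g t - g s)‖ ≤ S * (Kg * |(t : ℝ) - s| ^ (γ : ℝ)) := by
    have hS0 := (norm_nonneg _).trans hS
    refine (ContinuousLinearMap.le_opNorm _ _).trans ?_
    gcongr
    exact hg s t
  have h2 : |(t : ℝ) - s| ^ ((lam : ℝ) + γ) ≤ T ^ (lam : ℝ) * |(t : ℝ) - s| ^ (γ : ℝ) := by
    rw [Real.rpow_add_of_nonneg (abs_nonneg _) lam.coe_nonneg γ.coe_nonneg]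
    gcongr
    rw [abs_le]
    exact ⟨by linarith [t.2.1, s.2.2], by linarith [s.2.1, t.2.2]⟩
  have h3 : C * (Kf * Kg) * |(t : ℝ) - s| ^ ((lam : ℝ) + γ) ≤
      C * (Kf * Kg) * (T ^ (lam : ℝ) * |(t : ℝ) - s| ^ (γ : ℝ)) := by gcongr
  have h4 := norm_add_le (I t - I s - φ s (g t - g s)) (φ s (g t - g s))
  rw [sub_add_cancel] at h4
  calc _ ≤ _ := h4
    _ ≤ C * (Kf * Kg) * (T ^ (lam : ℝ) * |(t : ℝ) - s| ^ (γ : ℝ)) +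
        S * (Kg * |(t : ℝ) - s| ^ (γ : ℝ)) := add_le_add (h.trans h3) h1
    _ = _ := by ring

end Young

/-! ### The Young integral as a bounded bilinear operator -/

/-- The standing assumptions on the exponents and the time horizon. -/
structure YoungSetting (lam γ : ℝ≥0) (T : ℝ) : Prop where
  pos : 0 < T
  half_lt : 1 / 2 < lam
  lt : lam < γ

namespace YoungSetting

variable {lam γ : ℝ≥0} {T : ℝ}

theorem lam_pos (H : YoungSetting lam γ T) : 0 < lam := lt_of_le_of_lt (by positivity) H.half_lt

theorem gam_pos (H : YoungSetting lam γ T) : 0 < γ := H.lam_pos.trans H.lt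

theorem one_lt_add (H : YoungSetting lam γ T) : 1 < (lam : ℝ) + γ := by
  have h1 : ((1 / 2 : ℝ≥0) : ℝ) < lam := NNReal.coe_lt_coe.2 H.half_lt
  have h2 : (lam : ℝ) < γ := NNReal.coe_lt_coe.2 H.lt
  push_cast at h1
  linarith

theorem sub_pos (H : YoungSetting lam γ T) : 0 < (γ : ℝ) - lam :=
  _root_.sub_pos.2 (NNReal.coe_lt_coe.2 H.lt)

theorem youngConst_nonneg (H : YoungSetting lam γ T) : 0 ≤ youngConst lam γ :=
  YoungDelay.youngConst_nonneg (by exact_mod_cast H.lam_pos) (by exact_mod_cast H.gam_pos)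
    H.one_lt_add

theorem norm_apply_le_of_holderWith {W : Type*} [NormedAddCommGroup W] (H : YoungSetting lam γ T)
    {φ : Icc 0 T → W} {Kf : ℝ≥0} (hφ : HolderWith Kf lam φ)
    (t : Icc 0 T) : ‖φ t‖ ≤ ‖φ ⟨0, le_rfl, H.pos.le⟩‖ + Kf * T ^ (lam : ℝ) := by
  have h1 := holderWith_iff_norm_sub_le.1 hφ ⟨0, le_rfl, H.pos.le⟩ t
  have h2 := norm_sub_norm_le (φ t) (φ ⟨0, le_rfl, H.pos.le⟩)
  have h3 : |(t : ℝ) - 0| ≤ |T| := by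
    rw [sub_zero, abs_of_nonneg t.2.1, abs_of_pos H.pos]; exact t.2.2
  have h4 := mul_rpow_le_mul_rpow (α := lam) (K := Kf) Kf.coe_nonneg h3
  rw [abs_of_pos H.pos] at h4
  simp only at h1
  linarith

end YoungSetting

section YoungPath

variable {lam γ r : ℝ≥0} {T : ℝ} {F W : Type*} [NormedAddCommGroup F] [NormedSpace ℝ F]
  [NormedAddCommGroup W] [NormedSpace ℝ W]

/-- The Young integral `t ↦ ∫_0^t φ dg`; an arbitrary function where it does not exist. -/
def youngInt (φ : Icc 0 T → F →L[ℝ] W) (g : Icc 0 T → F) : Icc 0 T → W :=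
  Classical.epsilon (IsYoungIntegral φ g)

theorem IsYoungIntegral.eq_youngInt {φ : Icc 0 T → F →L[ℝ] W} {g : Icc 0 T → F} {I : Icc 0 T → W}
    (h : IsYoungIntegral φ g I) : I = youngInt φ g :=
  h.unique (Classical.epsilon_spec ⟨I, h⟩)

variable [CompleteSpace W]

theorem youngInt_spec (H : YoungSetting lam γ T) {φ : Icc 0 T → F →L[ℝ] W} {g : Icc 0 T → F}
    {Kf Kg : ℝ≥0} (hφ : HolderWith Kf lam φ) (hg : HolderWith Kg γ g) :
    IsYoungIntegral φ g (youngInt φ g) ∧ Continuous (youngInt φ g) ∧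
      ∀ s t, ‖youngInt φ g t - youngInt φ g s - φ s (g t - g s)‖ ≤
        youngConst lam γ * (Kf * Kg) * |(t : ℝ) - s| ^ ((lam : ℝ) + γ) := by
  obtain ⟨I, h0, hI⟩ := exists_youngIntegral H.pos H.lam_pos H.gam_pos H.one_lt_add hφ hg
  have hcont : Continuous I := by
    have hS : 0 ≤ ‖φ ⟨0, le_rfl, H.pos.le⟩‖ + Kf * T ^ (lam : ℝ) :=
      add_nonneg (norm_nonneg _) (mul_nonneg Kf.2 (Real.rpow_nonneg H.pos.le _))
    have hC : 0 ≤ (‖φ ⟨0, le_rfl, H.pos.le⟩‖ + Kf * T ^ (lam : ℝ) +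
        youngConst lam γ * T ^ (lam : ℝ) * Kf) * Kg :=
      mul_nonneg (add_nonneg hS (mul_nonneg (mul_nonneg H.youngConst_nonneg
        (Real.rpow_nonneg H.pos.le _)) Kf.2)) Kg.2
    exact (holderWith_of_norm_sub_le (α := γ) hC fun s t => norm_sub_le_of_young_bound
      H.youngConst_nonneg Kf.2 Kg.2 (holderWith_iff_norm_sub_le.1 hg)
      (H.norm_apply_le_of_holderWith hφ s) (hI s t)).continuous H.gam_pos
  have hyoung := isYoungIntegral_of_bound (hφ.continuous H.lam_pos) (hg.continuous H.gam_pos) hcont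
    h0 H.one_lt_add hI
  rw [← hyoung.eq_youngInt]
  exact ⟨hyoung, hcont, hI⟩

/-- The point `t ∨ 0` of `[0, T]`. -/
def posPart (hT : 0 < T) (t : Icc (0 - (r : ℝ)) T) : Icc 0 T :=
  ⟨max 0 t, le_max_left _ _, max_le hT.le t.2.2⟩

theorem posPart_incl (hT : 0 < T) (t : Icc 0 T) : posPart hT (incl r t) = t :=
  Subtype.ext (max_eq_right t.2.1)

theorem norm_youngInt_sub_le (H : YoungSetting lam γ T) {φ : Icc 0 T → F →L[ℝ] W} {Kf : ℝ≥0}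
    (hφ : HolderWith Kf lam φ) (g : HolderZero γ 0 0 T F) {S : ℝ} {s t : Icc 0 T} (hS : ‖φ s‖ ≤ S) :
    ‖youngInt φ g.1 t - youngInt φ g.1 s‖ ≤
      (S + youngConst lam γ * T ^ (lam : ℝ) * Kf) * ‖g‖ * |(t : ℝ) - s| ^ (γ : ℝ) :=
  norm_sub_le_of_young_bound H.youngConst_nonneg Kf.2 (norm_nonneg g) g.norm_sub_apply_le hS
    ((youngInt_spec H hφ g.2.1.holderWith).2.2 s t)

theorem rpow_gam_le (H : YoungSetting lam γ T) {s t d : ℝ} (hd : |t - s| ≤ d) :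
    |t - s| ^ (γ : ℝ) ≤ d ^ ((γ : ℝ) - lam) * |t - s| ^ (lam : ℝ) := by
  have e : (γ : ℝ) = (γ - lam) + lam := by ring
  conv_lhs => rw [e]
  rw [Real.rpow_add_of_nonneg (abs_nonneg _) H.sub_pos.le lam.coe_nonneg]
  have := H.sub_pos
  gcongr

/-- The path `t ↦ ∫_0^t φ dg`, extended by zero to `[-r, T]`. -/
def youngPath (H : YoungSetting lam γ T) (φ : HolderPath lam 0 T (F →L[ℝ] W))
    (g : HolderZero γ 0 0 T F) : Direction lam r W T :=
  ⟨fun t => youngInt φ.1 g.1 (posPart H.pos t), by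
    obtain ⟨Kf, hφ⟩ := φ.2
    set S := ‖φ.1 ⟨0, le_rfl, H.pos.le⟩‖ + Kf * T ^ (lam : ℝ)
    have hS : 0 ≤ S :=
      add_nonneg (norm_nonneg _) (mul_nonneg Kf.2 (Real.rpow_nonneg H.pos.le _))
    have hC : 0 ≤ (S + youngConst lam γ * T ^ (lam : ℝ) * Kf) * ‖g‖ :=
      mul_nonneg (add_nonneg hS (mul_nonneg (mul_nonneg H.youngConst_nonneg
        (Real.rpow_nonneg H.pos.le _)) Kf.2)) (norm_nonneg g)
    refine (holderWith_of_norm_sub_le (α := lam)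
      (C := (S + youngConst lam γ * T ^ (lam : ℝ) * Kf) * ‖g‖ * T ^ ((γ : ℝ) - lam))
      (mul_nonneg hC (Real.rpow_nonneg H.pos.le _)) fun s t => ?_).memHolder
    refine (norm_youngInt_sub_le H hφ g (H.norm_apply_le_of_holderWith hφ _)).trans ?_
    rw [mul_assoc _ (T ^ ((γ : ℝ) - lam))]
    refine mul_le_mul_of_nonneg_left ?_ hC
    refine (rpow_gam_le H (d := T) ?_).trans ?_
    · have h1 := (posPart H.pos t).2
      have h2 := (posPart H.pos s).2
      rw [abs_le]
      exact ⟨by linarith [h1.1, h2.2], by linarith [h1.2, h2.1]⟩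
    · refine mul_rpow_le_mul_rpow (Real.rpow_nonneg H.pos.le _) ?_
      refine (abs_max_sub_max_le_max _ _ _ _).trans ?_
      rw [sub_self, abs_zero, max_eq_right (abs_nonneg _)],
  fun t ht => by
    obtain ⟨Kf, hφ⟩ := φ.2
    refine (youngInt_spec H hφ g.2.1.holderWith).1.1 _ (max_eq_left (ht.trans ?_))
    simp⟩

theorem isYoungIntegral_youngInt (H : YoungSetting lam γ T) (φ : HolderPath lam 0 T (F →L[ℝ] W))
    (g : HolderZero γ 0 0 T F) : IsYoungIntegral φ.1 g.1 (youngInt φ.1 g.1) := by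
  obtain ⟨Kf, hφ⟩ := φ.2
  exact (youngInt_spec H hφ g.2.1.holderWith).1

theorem youngPath_apply (H : YoungSetting lam γ T) (φ : HolderPath lam 0 T (F →L[ℝ] W))
    (g : HolderZero γ 0 0 T F) (t : Icc (0 - (r : ℝ)) T) :
    youngPath H φ g t = youngInt φ.1 g.1 (posPart H.pos t) := rfl

theorem youngPath_incl (H : YoungSetting lam γ T) (φ : HolderPath lam 0 T (F →L[ℝ] W))
    (g : HolderZero γ 0 0 T F) (t : Icc 0 T) :
    youngPath (r := r) H φ g (incl r t) = youngInt φ.1 g.1 t := by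
  rw [youngPath_apply, posPart_incl]

/-- The Young integral is linear in the germ `φ_s (g_t - g_s)`. -/
theorem youngInt_linear (H : YoungSetting lam γ T) {φ φ₁ φ₂ : HolderPath lam 0 T (F →L[ℝ] W)}
    {g g₁ g₂ : HolderZero γ 0 0 T F} (c₁ c₂ : ℝ)
    (h : ∀ s t, φ.1 s (g t - g s) = c₁ • φ₁.1 s (g₁ t - g₁ s) + c₂ • φ₂.1 s (g₂ t - g₂ s)) :
    youngInt φ.1 g.1 = c₁ • youngInt φ₁.1 g₁.1 + c₂ • youngInt φ₂.1 g₂.1 := by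
  obtain ⟨K, hφ⟩ := φ.2
  obtain ⟨K₁, hφ₁⟩ := φ₁.2
  obtain ⟨K₂, hφ₂⟩ := φ₂.2
  obtain ⟨i₁, cont₁, e₁⟩ := youngInt_spec H hφ₁ g₁.2.1.holderWith
  obtain ⟨i₂, cont₂, e₂⟩ := youngInt_spec H hφ₂ g₂.2.1.holderWith
  refine (isYoungIntegral_of_bound (μ := lam + γ)
    (C := |c₁| * (youngConst lam γ * (K₁ * nnHolderNorm γ g₁.1)) +
      |c₂| * (youngConst lam γ * (K₂ * nnHolderNorm γ g₂.1)))
    (hφ.continuous H.lam_pos) (g.2.1.holderWith.continuous H.gam_pos)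
    ((cont₁.const_smul c₁).add (cont₂.const_smul c₂)) ?_ H.one_lt_add ?_).eq_youngInt.symm
  · intro t ht
    simp [i₁.1 t ht, i₂.1 t ht]
  · intro s t
    have e : (c₁ • youngInt φ₁.1 g₁.1 + c₂ • youngInt φ₂.1 g₂.1) t -
        (c₁ • youngInt φ₁.1 g₁.1 + c₂ • youngInt φ₂.1 g₂.1) s - φ.1 s (g.1 t - g.1 s) =
        c₁ • (youngInt φ₁.1 g₁.1 t - youngInt φ₁.1 g₁.1 s - φ₁.1 s (g₁.1 t - g₁.1 s)) +
        c₂ • (youngInt φ₂.1 g₂.1 t - youngInt φ₂.1 g₂.1 s - φ₂.1 s (g₂.1 t - g₂.1 s)) := by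
      rw [h]
      simp only [Pi.add_apply, Pi.smul_apply, smul_sub]
      abel
    rw [e]
    refine (norm_add_le _ _).trans ?_
    rw [norm_smul, norm_smul, Real.norm_eq_abs, Real.norm_eq_abs, add_mul, mul_assoc |c₁|,
      mul_assoc |c₂|]
    exact add_le_add (mul_le_mul_of_nonneg_left (e₁ s t) (abs_nonneg _))
      (mul_le_mul_of_nonneg_left (e₂ s t) (abs_nonneg _))

theorem youngPath_linear (H : YoungSetting lam γ T) {φ φ₁ φ₂ : HolderPath lam 0 T (F →L[ℝ] W)}
    {g g₁ g₂ : HolderZero γ 0 0 T F} (c₁ c₂ : ℝ)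
    (h : ∀ s t, φ.1 s (g t - g s) = c₁ • φ₁.1 s (g₁ t - g₁ s) + c₂ • φ₂.1 s (g₂ t - g₂ s)) :
    youngPath (r := r) H φ g = c₁ • youngPath H φ₁ g₁ + c₂ • youngPath H φ₂ g₂ := by
  ext t
  exact congrFun (youngInt_linear H c₁ c₂ h) (posPart H.pos t)

/-- The Young integral as a bilinear map. -/
def youngLin (H : YoungSetting lam γ T) :
    HolderPath lam 0 T (F →L[ℝ] W) →ₗ[ℝ] HolderZero γ 0 0 T F →ₗ[ℝ] Direction lam r W T :=
  LinearMap.mk₂ ℝ (youngPath H)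
    (fun φ₁ φ₂ g => by
      simpa using youngPath_linear (r := r) H (φ := φ₁ + φ₂) (φ₁ := φ₁) (φ₂ := φ₂) (g := g)
        (g₁ := g) (g₂ := g) 1 1 fun s t => by simp)
    (fun c φ g => by
      simpa using youngPath_linear (r := r) H (φ := c • φ) (φ₁ := φ) (φ₂ := φ) (g := g)
        (g₁ := g) (g₂ := g) c 0 fun s t => by simp)
    (fun φ g₁ g₂ => by
      simpa using youngPath_linear (r := r) H (φ := φ) (φ₁ := φ) (φ₂ := φ) (g := g₁ + g₂)
        (g₁ := g₁) (g₂ := g₂) 1 1 fun s t => by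
          simp only [HolderZero.add_apply, one_smul, ← map_add]; congr 1; abel)
    (fun c φ g => by
      simpa using youngPath_linear (r := r) H (φ := φ) (φ₁ := φ) (φ₂ := φ) (g := c • g)
        (g₁ := g) (g₂ := g) c 0 fun s t => by
          simp only [HolderZero.smul_apply, zero_smul, add_zero, ← smul_sub, map_smul])

theorem youngLin_apply (H : YoungSetting lam γ T) (φ : HolderPath lam 0 T (F →L[ℝ] W))
    (g : HolderZero γ 0 0 T F) : youngLin (r := r) H φ g = youngPath H φ g := rfl

open HolderZero

/-- Causality of the Young integral. -/
theorem stopAt_youngLin_congr (H : YoungSetting lam γ T) {φ ψ : HolderPath lam 0 T (F →L[ℝ] W)}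
    (g : HolderZero γ 0 0 T F) {τ : ℝ} (hτ : 0 ≤ τ)
    (h : ∀ t : Icc 0 T, (t : ℝ) ≤ τ → φ.1 t = ψ.1 t) :
    stopAt τ (youngLin (r := r) H φ g) = stopAt τ (youngLin H ψ g) := by
  have hr : 0 - (r : ℝ) ≤ τ := by linarith [r.coe_nonneg]
  refine (stopAt_eq_stop_iff hr).2 fun t ht => ?_
  exact (isYoungIntegral_youngInt H φ g).eq_of_le (isYoungIntegral_youngInt H ψ g) h _
    (max_le hτ ht)

/-- The main estimate: over a time interval `[a, b]` the Young integral has a small `lam`-Hölder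
norm, because its integrator has the larger Hölder exponent `γ`. -/
theorem norm_stopAt_youngLin_sub_le (H : YoungSetting lam γ T) {φ : HolderPath lam 0 T (F →L[ℝ] W)}
    {Kf : ℝ≥0} (hφ : HolderWith Kf lam φ.1) (g : HolderZero γ 0 0 T F) {a b S : ℝ} (ha : 0 ≤ a)
    (hab : a ≤ b) (hb : b ≤ T) (hS0 : 0 ≤ S)
    (hS : ∀ t : Icc 0 T, a ≤ t → (t : ℝ) ≤ b → ‖φ.1 t‖ ≤ S) :
    ‖stopAt b (youngLin (r := r) H φ g) - stopAt a (youngLin H φ g)‖ ≤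
      (S + youngConst lam γ * T ^ (lam : ℝ) * Kf) * ‖g‖ * (b - a) ^ ((γ : ℝ) - lam) := by
  have hC : 0 ≤ (S + youngConst lam γ * T ^ (lam : ℝ) * Kf) * ‖g‖ :=
    mul_nonneg (add_nonneg hS0 (mul_nonneg (mul_nonneg H.youngConst_nonneg
      (Real.rpow_nonneg H.pos.le _)) Kf.2)) (norm_nonneg g)
  have hba : 0 ≤ b - a := by linarith
  set I := youngInt φ.1 g.1
  -- the time `t` moved to the nearest point of `[a, b]`
  set q : Icc (0 - (r : ℝ)) T → Icc 0 T := fun t =>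
    ⟨max a (min t b), ha.trans (le_max_left _ _), max_le (hab.trans hb)
      ((min_le_right _ _).trans hb)⟩ with hq
  have hr := r.coe_nonneg
  have key : ∀ t, (stopAt b (youngLin H φ g) - stopAt a (youngLin H φ g) : Direction lam r W T) t =
      I (q t) - I ⟨a, ha, hab.trans hb⟩ := by
    intro t
    change I (posPart H.pos (stopTime b t)) - I (posPart H.pos (stopTime a t)) = _
    rcases le_total (t : ℝ) a with h | h
    · rw [stopTime_of_le h, stopTime_of_le (h.trans hab)]
      have : q t = ⟨a, ha, hab.trans hb⟩ := Subtype.ext (by simp [hq, h])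
      rw [this, sub_self, sub_self]
    · have e1 : posPart H.pos (stopTime b t) = q t := by
        apply Subtype.ext
        simp only [posPart, stopTime, hq]
        grind
      have e2 : posPart H.pos (stopTime a t) = ⟨a, ha, hab.trans hb⟩ := by
        apply Subtype.ext
        simp only [posPart, stopTime]
        grind
      rw [e1, e2]
  refine norm_le_of_norm_sub_le (mul_nonneg hC (Real.rpow_nonneg hba _)) fun s t => ?_
  rw [key, key, sub_sub_sub_cancel_right]
  have hqa : ∀ t, a ≤ q t := fun t => le_max_left _ _
  have hqb : ∀ t, (q t : ℝ) ≤ b := fun t => max_le hab (min_le_right _ _)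
  refine (norm_youngInt_sub_le H hφ g (hS _ (hqa s) (hqb s))).trans ?_
  rw [mul_assoc _ ((b - a) ^ ((γ : ℝ) - lam))]
  refine mul_le_mul_of_nonneg_left ?_ hC
  refine (rpow_gam_le H (d := b - a) ?_).trans ?_
  · rw [abs_le]
    exact ⟨by linarith [hqa t, hqb s], by linarith [hqa s, hqb t]⟩
  · refine mul_rpow_le_mul_rpow (Real.rpow_nonneg hba _) ?_
    refine (abs_max_sub_max_le_max _ _ _ _).trans ?_
    rw [sub_self, abs_zero, max_eq_right (abs_nonneg _)]
    refine (abs_min_sub_min_le_max _ _ _ _).trans ?_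
    rw [sub_self, abs_zero, max_eq_left (abs_nonneg _)]

/-- The constant in the short-time estimate for Young integrals. -/
def youngGain (lam γ : ℝ≥0) (T : ℝ) : ℝ := (1 + youngConst lam γ) * T ^ (lam : ℝ)

theorem YoungSetting.youngGain_nonneg (H : YoungSetting lam γ T) : 0 ≤ youngGain lam γ T :=
  mul_nonneg (by linarith [H.youngConst_nonneg]) (Real.rpow_nonneg H.pos.le _)

/-- The short-time estimate for integrands that vanish up to the time `a`. -/
theorem norm_stopAt_youngLin_le (H : YoungSetting lam γ T) {φ : HolderPath lam 0 T (F →L[ℝ] W)}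
    {Kf : ℝ≥0} (hφ : HolderWith Kf lam φ.1) (g : HolderZero γ 0 0 T F) {a b : ℝ} (ha : 0 ≤ a)
    (hab : a ≤ b) (hb : b ≤ T) (h0 : ∀ t : Icc 0 T, (t : ℝ) ≤ a → φ.1 t = 0) :
    ‖stopAt b (youngLin (r := r) H φ g)‖ ≤
      youngGain lam γ T * Kf * ‖g‖ * (b - a) ^ ((γ : ℝ) - lam) := by
  have hT := Real.rpow_nonneg H.pos.le (lam : ℝ)
  have hz : stopAt a (youngLin (r := r) H φ g) = 0 := by
    have : stopAt a (youngLin (r := r) H φ g) =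
        stopAt a (youngLin (r := r) H (0 : HolderPath lam 0 T (F →L[ℝ] W)) g) :=
      stopAt_youngLin_congr H g ha h0
    rw [this, map_zero, LinearMap.zero_apply, map_zero]
  have := norm_stopAt_youngLin_sub_le (r := r) H hφ g ha hab hb (S := Kf * T ^ (lam : ℝ))
    (mul_nonneg Kf.2 hT) ?_
  · rw [hz, sub_zero] at this
    refine this.trans (le_of_eq ?_)
    rw [youngGain]; ring
  · intro t _ _
    have h1 := H.norm_apply_le_of_holderWith hφ t
    rwa [h0 ⟨0, le_rfl, H.pos.le⟩ ha, norm_zero, zero_add] at h1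

/-- The inclusion of the Hölder functions that vanish at `0` into all Hölder functions. -/
def toHolderPath {M : Type*} [NormedAddCommGroup M] [NormedSpace ℝ M] :
    HolderZero lam 0 0 T M →ₗ[ℝ] HolderPath lam 0 T M where
  toFun φ := ⟨φ.1, φ.2.1⟩
  map_add' _ _ := rfl
  map_smul' _ _ := rfl

/-- `φ ↦ (g ↦ ∫ φ dg)` as a bounded bilinear operator on integrands that vanish at `0`. -/
def youngCLM (H : YoungSetting lam γ T) :
    HolderZero lam 0 0 T (F →L[ℝ] W) →L[ℝ] HolderZero γ 0 0 T F →L[ℝ] Direction lam r W T :=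
  LinearMap.mkContinuous₂ ((youngLin H).comp toHolderPath)
    (youngGain lam γ T * T ^ ((γ : ℝ) - lam)) fun φ g => by
      have h := norm_stopAt_youngLin_le (r := r) H (φ := toHolderPath φ) φ.2.1.holderWith g le_rfl
        H.pos.le le_rfl fun t ht => φ.2.2 t (by simpa using ht)
      rw [(isStopping (by simp)).final, sub_zero] at h
      refine h.trans (le_of_eq ?_)
      rw [norm_def φ]; ring

/-- `g ↦ ∫ φ dg` as a bounded operator. -/
def youngRight (H : YoungSetting lam γ T) (φ : HolderPath lam 0 T (F →L[ℝ] W)) :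
    HolderZero γ 0 0 T F →L[ℝ] Direction lam r W T :=
  LinearMap.mkContinuous (youngLin H φ)
    ((‖φ.1 ⟨0, le_rfl, H.pos.le⟩‖ + nnHolderNorm lam φ.1 * T ^ (lam : ℝ) +
      youngConst lam γ * T ^ (lam : ℝ) * nnHolderNorm lam φ.1) * T ^ ((γ : ℝ) - lam)) fun g => by
      have h := norm_stopAt_youngLin_sub_le (r := r) H (φ := φ) φ.2.holderWith g le_rfl
        H.pos.le le_rfl (S := ‖φ.1 ⟨0, le_rfl, H.pos.le⟩‖ + nnHolderNorm lam φ.1 * T ^ (lam : ℝ))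
        (add_nonneg (norm_nonneg _)
          (mul_nonneg (NNReal.coe_nonneg _) (Real.rpow_nonneg H.pos.le _)))
        fun t _ _ => H.norm_apply_le_of_holderWith φ.2.holderWith t
      rw [(isStopping (by simp)).final, (isStopping (by simp)).zero, sub_zero] at h
      change ‖_ - 0‖ ≤ _ at h
      rw [sub_zero] at h
      refine h.trans (le_of_eq ?_)
      ring

theorem youngRight_apply (H : YoungSetting lam γ T) (φ : HolderPath lam 0 T (F →L[ℝ] W))
    (g : HolderZero γ 0 0 T F) : youngRight (r := r) H φ g = youngLin H φ g := rfl

end YoungPath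

/-! ### The coefficient along delayed paths -/

section Coefficient

variable {lam γ r : ℝ≥0} {V M : Type*} [NormedAddCommGroup V] [NormedSpace ℝ V]
  {ξ : HolderPath lam (-(r : ℝ)) 0 V} {T : ℝ}

theorem vadd_apply (ℓ : Direction lam r V T) (Z : DelayedPath ξ T) (t : Icc (0 - (r : ℝ)) T) :
    (ℓ +ᵥ Z).1.1 t = ℓ t + Z.1.1 t := rfl

theorem DelayedPath.ext {Z Z' : DelayedPath ξ T} (h : ∀ t, Z.1.1 t = Z'.1.1 t) : Z = Z' :=
  Subtype.ext (Subtype.ext (funext h))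

theorem vadd_vadd_eq (ℓ ℓ' : Direction lam r V T) (Z : DelayedPath ξ T) :
    ℓ' +ᵥ (ℓ +ᵥ Z) = (ℓ + ℓ') +ᵥ Z :=
  DelayedPath.ext fun t => by
    simp only [vadd_apply, HolderZero.add_apply]; abel

theorem vsub_vadd_eq (y Z : DelayedPath ξ T) : (y -ᵥ Z) +ᵥ Z = y :=
  DelayedPath.ext fun _ => sub_add_cancel _ _

theorem vadd_vsub_vadd_eq (ℓ ℓ' : Direction lam r V T) (Z : DelayedPath ξ T) :
    (ℓ' +ᵥ Z) -ᵥ (ℓ +ᵥ Z) = ℓ' - ℓ :=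
  HolderZero.ext fun _ => add_sub_add_right_eq_sub _ _ _

/-- The path which continues the initial condition by the constant `ξ_0`; it serves as origin of the
affine space of delayed paths. -/
def basePath (ξ : HolderPath lam (-(r : ℝ)) 0 V) (T : ℝ) : DelayedPath ξ T :=
  ⟨⟨fun s => ξ.1 ⟨min s 0, le_min (by linarith [s.2.1]) (by simp), min_le_right _ _⟩, by
    refine (holderWith_of_norm_sub_le (nnHolderNorm lam ξ.1).coe_nonneg fun s t =>
      (holderWith_iff_norm_sub_le.1 ξ.2.holderWith _ _).trans
        (mul_rpow_le_mul_rpow (NNReal.coe_nonneg _) ?_)).memHolder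
    refine (abs_min_sub_min_le_max _ _ _ _).trans ?_
    rw [sub_self, abs_zero, max_eq_left (abs_nonneg _)]⟩,
  fun s θ h => congrArg ξ.1 (Subtype.ext (by simp only [h, min_eq_left θ.2.2]))⟩

theorem basePath_incl (t : Icc 0 T) : (basePath ξ T).1.1 (incl r t) = valueAtZero ξ :=
  congrArg ξ.1 (Subtype.ext (min_eq_right t.2.1))

theorem Direction.ext_incl {Z Z' : Direction lam r V T}
    (h : ∀ t : Icc 0 T, Z (incl r t) = Z' (incl r t)) : Z = Z' := by
  ext t
  rcases le_total (t : ℝ) 0 with h0 | h0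
  · rw [Z.2.2 t (h0.trans (le_max_right _ _)), Z'.2.2 t (h0.trans (le_max_right _ _))]
  · exact h ⟨t, h0, t.2.2⟩

/-- Causality of the coefficient: `f(𝒵^y_s)` only depends on `y` up to the time `s`. -/
theorem delayMap_congr (f : HolderPath lam (-(r : ℝ)) 0 V → M)
    {y y' : HolderPath lam (0 - (r : ℝ)) T V} {s : Icc 0 T}
    (h : ∀ t : Icc (0 - (r : ℝ)) T, (t : ℝ) ≤ s → y.1 t = y'.1 t) :
    delayMap f y s = delayMap f y' s :=
  congrArg f (Subtype.ext (funext fun θ => h _ (by simpa using θ.2.2)))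

theorem delayMap_vadd_congr (f : HolderPath lam (-(r : ℝ)) 0 V → M) {ℓ ℓ' : Direction lam r V T}
    (Z : DelayedPath ξ T) {τ : ℝ} (hτ : 0 ≤ τ) (h : HolderZero.stopAt τ ℓ = HolderZero.stopAt τ ℓ')
    (s : Icc 0 T) (hs : (s : ℝ) ≤ τ) :
    delayMap f (ℓ +ᵥ Z).1 s = delayMap f (ℓ' +ᵥ Z).1 s := by
  rw [HolderZero.stopAt_eq_stop_iff (by linarith [r.coe_nonneg])] at h
  refine delayMap_congr f fun t ht => ?_
  rw [vadd_apply, vadd_apply, h t (ht.trans hs)]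

theorem nnHolderNorm_vadd_le (ℓ : Direction lam r V T) (Z : DelayedPath ξ T) :
    (nnHolderNorm lam (ℓ +ᵥ Z).1.1 : ℝ) ≤ ‖ℓ‖ + nnHolderNorm lam Z.1.1 := by
  rw [HolderZero.norm_def]
  exact_mod_cast ℓ.2.1.nnHolderNorm_add_le Z.1.2

variable [NormedAddCommGroup M]

/-- A coefficient which is Lipschitz in the uniform norm maps Hölder paths to Hölder paths. -/
theorem holderWith_delayMap {f : HolderPath lam (-(r : ℝ)) 0 V → M} {K : ℝ≥0}
    (hK : ∀ ζ₁ ζ₂, ‖f ζ₂ - f ζ₁‖ ≤ K * ⨆ θ : Icc (-(r : ℝ)) 0, ‖ζ₂.1 θ - ζ₁.1 θ‖)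
    (y : HolderPath lam (0 - (r : ℝ)) T V) :
    HolderWith (K * nnHolderNorm lam y.1) lam (delayMap f y) := by
  refine holderWith_iff_norm_sub_le.2 fun s t => (hK _ _).trans ?_
  rw [NNReal.coe_mul, mul_assoc]
  refine mul_le_mul_of_nonneg_left ?_ K.coe_nonneg
  have : Nonempty (Icc (-(r : ℝ)) 0) := ⟨⟨0, by simp, le_rfl⟩⟩
  refine ciSup_le fun θ => (holderWith_iff_norm_sub_le.1 y.2.holderWith _ _).trans (le_of_eq ?_)
  simp only [add_sub_add_right_eq_sub]

theorem Hypothesis1.memHolder {f : HolderPath lam (-(r : ℝ)) 0 V → M} (h1 : Hypothesis1 f)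
    (y : HolderPath lam (0 - (r : ℝ)) T V) : MemHolder lam (delayMap f y) := by
  obtain ⟨K, hK, -, hlip⟩ := h1
  exact (holderWith_delayMap (K := ⟨K, hK.le⟩) hlip y).memHolder

variable [NormedSpace ℝ M] {f : HolderPath lam (-(r : ℝ)) 0 V → M}

/-- The coefficient `f(𝒵^y)` along a delayed path, as an element of the Hölder space. -/
def coeffPath (h1 : Hypothesis1 f) (y : DelayedPath ξ T) : HolderPath lam 0 T M :=
  ⟨delayMap f y.1, h1.memHolder y.1⟩

/-- The increment `𝒰(Z + ℓ) - 𝒰(Z)` of the delay map from the base path `Z`. Since it vanishes at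
time `0`, it lies in a space normed by the Hölder seminorm. -/
def coeffIncrement (h1 : Hypothesis1 f) (ξ : HolderPath lam (-(r : ℝ)) 0 V)
    (ℓ : Direction lam r V T) : HolderZero lam 0 0 T M :=
  ⟨(coeffPath h1 (ℓ +ᵥ basePath ξ T) - coeffPath h1 (basePath ξ T)).1,
    (coeffPath h1 (ℓ +ᵥ basePath ξ T) - coeffPath h1 (basePath ξ T)).2, fun t ht => by
    refine sub_eq_zero.2 (delayMap_congr f fun u hu => ?_)
    rw [max_self] at ht
    rw [vadd_apply, ℓ.2.2 u (hu.trans (ht.trans (le_max_right _ _))), zero_add]⟩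

theorem coeffIncrement_apply (h1 : Hypothesis1 f) (ℓ : Direction lam r V T) (s : Icc 0 T) :
    coeffIncrement h1 ξ ℓ s =
      delayMap f (ℓ +ᵥ basePath ξ T).1 s - delayMap f (basePath ξ T).1 s := rfl

theorem HasDelayMapDerivAt.hasFDerivAt (h1 : Hypothesis1 f) {ℓ : Direction lam r V T}
    {A : Direction lam r V T →L[ℝ] HolderZero lam 0 0 T M}
    (hA : HasDelayMapDerivAt f (ℓ +ᵥ basePath ξ T) A) :
    HasFDerivAt (coeffIncrement h1 ξ) A ℓ := by
  rw [hasFDerivAt_iff_isLittleO_nhds_zero, Asymptotics.isLittleO_iff]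
  intro ε hε
  filter_upwards [hA ⟨ε, hε.le⟩ hε] with k hk
  refine HolderZero.norm_le_of_norm_sub_le (by positivity) fun s t => ?_
  have := holderWith_iff_norm_sub_le.1 hk s t
  simp only [HolderZero.sub_apply, coeffIncrement_apply]
  rw [vadd_vadd_eq] at this
  refine le_trans (le_of_eq ?_) this
  congr 1
  abel

/-- The derivative of a causal map is causal. -/
theorem HasDelayMapDerivAt.stopAt_eq_zero (h1 : Hypothesis1 f) {ℓ : Direction lam r V T}
    {A : Direction lam r V T →L[ℝ] HolderZero lam 0 0 T M}
    (hA : HasDelayMapDerivAt f (ℓ +ᵥ basePath ξ T) A) {τ : ℝ} (hτ : 0 ≤ τ)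
    {Z : Direction lam r V T} (hZ : HolderZero.stopAt τ Z = 0) (s : Icc 0 T) (hs : (s : ℝ) ≤ τ) :
    A Z s = 0 := by
  have hline : HasDerivAt (fun u : ℝ => ℓ + u • Z) Z 0 := by
    simpa using ((hasDerivAt_id (0 : ℝ)).smul_const Z).const_add ℓ
  have hF : HasFDerivAt (coeffIncrement h1 ξ) A (ℓ + (0 : ℝ) • Z) := by
    rw [zero_smul, add_zero]
    exact hA.hasFDerivAt h1
  have hd := (HolderZero.evalCLM s).hasFDerivAt.comp_hasDerivAt (0 : ℝ)
    (hF.comp_hasDerivAt (0 : ℝ) hline)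
  refine hd.unique ?_
  have : (HolderZero.evalCLM s ∘ coeffIncrement h1 ξ ∘ fun u : ℝ => ℓ + u • Z) =
      fun _ => coeffIncrement h1 ξ ℓ s := by
    funext u
    simp only [Function.comp_apply, HolderZero.evalCLM_apply, coeffIncrement_apply]
    rw [delayMap_vadd_congr f (ℓ' := ℓ) _ hτ (by simp [hZ]) s hs]
  rw [this]
  exact hasDerivAt_const _ _

end Coefficient

/-- Continuous differentiability of the delay map, in strict form. -/
theorem Hypothesis3.hasStrictFDerivAt {lam r : ℝ≥0} {T : ℝ} {V F : Type*} [NormedAddCommGroup V]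
    [NormedSpace ℝ V] [NormedAddCommGroup F] [NormedSpace ℝ F] {ξ : HolderPath lam (-(r : ℝ)) 0 V}
    {f : HolderPath lam (-(r : ℝ)) 0 V → F →L[ℝ] V} (hT : 0 < T) (h1 : Hypothesis1 f)
    {x : Icc 0 T → F}
    {DU : ∀ t : ℝ, DelayedPath ξ t →
      (Direction lam r V t →L[ℝ] HolderZero lam 0 0 t (F →L[ℝ] V))}
    (h3 : Hypothesis3 f ξ x DU) (ℓ : Direction lam r V T) :
    HasStrictFDerivAt (coeffIncrement h1 ξ) (DU T (ℓ +ᵥ basePath ξ T)) ℓ := by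
  refine hasStrictFDerivAt_of_hasFDerivAt_of_continuousAt
    (f' := fun m => DU T (m +ᵥ basePath ξ T))
    (Filter.Eventually.of_forall fun m => (h3.hasDeriv T hT le_rfl _).hasFDerivAt h1) ?_
  have hc := h3.continuous T hT le_rfl (ℓ +ᵥ basePath ξ T)
  simp only [vadd_vadd_eq] at hc
  have hsub : ContinuousAt (fun m : Direction lam r V T => m - ℓ) ℓ := by fun_prop
  have := ContinuousAt.comp (x := ℓ) (g := fun k => DU T ((ℓ + k) +ᵥ basePath ξ T))
    (f := fun m => m - ℓ) (by simpa using hc) hsub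
  simpa [Function.comp_def] using this


/-! ### The Young delay equation -/

section Equation

variable {lam γ r : ℝ≥0} {T : ℝ} {V F : Type*} [NormedAddCommGroup V] [NormedSpace ℝ V]
  [CompleteSpace V] [NormedAddCommGroup F] [NormedSpace ℝ F]
  {ξ : HolderPath lam (-(r : ℝ)) 0 V} {f : HolderPath lam (-(r : ℝ)) 0 V → F →L[ℝ] V}

open HolderZero

/-- A Hölder driver, shifted so that it vanishes at time `0`. -/
def centered (hT : 0 < T) (x : HolderPath γ 0 T F) : HolderZero γ 0 0 T F :=
  ⟨fun t => x.1 t - x.1 ⟨0, le_rfl, hT.le⟩, by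
    refine (holderWith_iff_norm_sub_le.2 fun s t => ?_ :
      HolderWith (nnHolderNorm γ x.1) γ _).memHolder
    rw [sub_sub_sub_cancel_right]
    exact holderWith_iff_norm_sub_le.1 x.2.holderWith s t, fun t ht => by
    rw [max_self] at ht
    exact sub_eq_zero.2 (congrArg x.1 (Subtype.ext (le_antisymm ht t.2.1)))⟩

theorem centered_add_increment (hT : 0 < T) (x : HolderPath γ 0 T F) (h : HolderZero γ 0 0 T F)
    (s t : Icc 0 T) :
    (centered hT x + h) t - (centered hT x + h) s = (x.1 + h.1) t - (x.1 + h.1) s := by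
  change (x.1 t - _ + h t) - (x.1 s - _ + h s) = (x.1 t + h t) - (x.1 s + h s)
  abel

/-- A Young integral against `x + h`, as a value of the integration operator. -/
theorem isYoungIntegral_add_iff (H : YoungSetting lam γ T) (φ : HolderPath lam 0 T (F →L[ℝ] V))
    (x : HolderPath γ 0 T F) (h : HolderZero γ 0 0 T F) {I : Icc 0 T → V} :
    IsYoungIntegral φ.1 (x.1 + h.1) I ↔
      ∀ t, I t = youngLin (r := r) H φ (centered H.pos x + h) (incl r t) := by
  have hY := isYoungIntegral_youngInt H φ (centered H.pos x + h)
  constructor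
  · intro hI t
    rw [youngLin_apply, youngPath_incl,
      (hI.congr_increments (centered_add_increment H.pos x h)).eq_youngInt]
  · intro hI
    have : I = youngInt φ.1 (centered H.pos x + h).1 := by
      funext t
      rw [hI, youngLin_apply, youngPath_incl]
    rw [this]
    exact hY.congr_increments fun s t => (centered_add_increment H.pos x h s t).symm

theorem isYoungIntegral_iff (H : YoungSetting lam γ T) (φ : HolderPath lam 0 T (F →L[ℝ] V))
    (k : HolderZero γ 0 0 T F) {I : Icc 0 T → V} :
    IsYoungIntegral φ.1 k.1 I ↔ ∀ t, I t = youngLin (r := r) H φ k (incl r t) := by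
  constructor
  · intro hI t
    rw [youngLin_apply, youngPath_incl, hI.eq_youngInt]
  · intro hI
    have : I = youngInt φ.1 k.1 := by
      funext t
      rw [hI, youngLin_apply, youngPath_incl]
    rw [this]
    exact isYoungIntegral_youngInt H φ k

/-- The right-hand side `∫ f(𝒵^y) dg` of the equation, for `y` at distance `ℓ` from the base
path. -/
def rhs (H : YoungSetting lam γ T) (h1 : Hypothesis1 f) (ξ : HolderPath lam (-(r : ℝ)) 0 V)
    (g : HolderZero γ 0 0 T F) (ℓ : Direction lam r V T) : Direction lam r V T :=
  youngLin H (coeffPath h1 (ℓ +ᵥ basePath ξ T)) g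

theorem isSolution_iff (H : YoungSetting lam γ T) (h1 : Hypothesis1 f) (x : HolderPath γ 0 T F)
    (h : HolderZero γ 0 0 T F) (ℓ : Direction lam r V T) :
    IsSolution f (x.1 + h.1) (ℓ +ᵥ basePath ξ T) ↔
      rhs H h1 ξ (centered H.pos x + h) ℓ = ℓ := by
  have hval : ∀ t : Icc 0 T, (ℓ +ᵥ basePath ξ T).1.1 (incl r t) =
      valueAtZero ξ + ℓ (incl r t) := fun t => by
    rw [vadd_apply, basePath_incl, add_comm]
  have hyoung := fun I => isYoungIntegral_add_iff (r := r) H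
    (coeffPath h1 (ℓ +ᵥ basePath ξ T)) x h (I := I)
  constructor
  · rintro ⟨I, hI, hy⟩
    refine Direction.ext_incl fun t => ?_
    have h2 := hy t
    rw [hval, add_right_inj] at h2
    rw [h2, (hyoung I).1 hI t]
    rfl
  · intro hfix
    refine ⟨fun t => ℓ (incl r t), (hyoung _).2 fun t => ?_, hval⟩
    conv_lhs => rw [← hfix]
    rfl

theorem exists_forall_mul_rpow_le (A : ℝ) {κ ε : ℝ} (hκ : 0 < κ) (hε : 0 < ε) :
    ∃ δ > 0, ∀ d, 0 ≤ d → d ≤ δ → A * d ^ κ ≤ ε := by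
  have hc : Filter.Tendsto (fun d : ℝ => A * d ^ κ) (𝓝 0) (𝓝 0) := by
    have : Continuous fun d : ℝ => A * d ^ κ :=
      continuous_const.mul (continuous_id.rpow_const fun _ => Or.inr hκ.le)
    simpa [Real.zero_rpow hκ.ne'] using this.tendsto 0
  obtain ⟨δ, hδ, h⟩ := Metric.eventually_nhds_iff.1 (hc.eventually_le_const hε)
  refine ⟨δ / 2, by positivity, fun d hd hdδ => h ?_⟩
  rw [Real.dist_eq, sub_zero, abs_of_nonneg hd]
  linarith

/-- Linear growth of the right-hand side, with a small constant over short time intervals. -/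
theorem norm_stopAt_rhs_sub_le (H : YoungSetting lam γ T) (h1 : Hypothesis1 f) {K : ℝ≥0}
    (hbd : ∀ ζ, ‖f ζ‖ ≤ K)
    (hlip : ∀ ζ₁ ζ₂, ‖f ζ₂ - f ζ₁‖ ≤ K * ⨆ θ : Icc (-(r : ℝ)) 0, ‖ζ₂.1 θ - ζ₁.1 θ‖)
    (g : HolderZero γ 0 0 T F) (ℓ : Direction lam r V T) {a b : ℝ} (ha : 0 ≤ a) (hab : a ≤ b)
    (hb : b ≤ T) :
    ‖stopAt b (rhs H h1 ξ g ℓ) - stopAt a (rhs H h1 ξ g ℓ)‖ ≤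
      (K + youngConst lam γ * T ^ (lam : ℝ) * K * (1 + nnHolderNorm lam (basePath ξ T).1.1)) *
        ‖g‖ * (b - a) ^ ((γ : ℝ) - lam) * (1 + ‖ℓ‖) := by
  set B : ℝ := (nnHolderNorm lam (basePath ξ T).1.1 : ℝ)
  have hB0 : 0 ≤ B := NNReal.coe_nonneg _
  have hC : 0 ≤ youngConst lam γ * T ^ (lam : ℝ) * K :=
    mul_nonneg (mul_nonneg H.youngConst_nonneg (Real.rpow_nonneg H.pos.le _)) K.2
  have hd := Real.rpow_nonneg (show 0 ≤ b - a by linarith) ((γ : ℝ) - lam)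
  have hφ : HolderWith (K * nnHolderNorm lam (ℓ +ᵥ basePath ξ T).1.1) lam
      (coeffPath h1 (ℓ +ᵥ basePath ξ T)).1 := holderWith_delayMap hlip _
  have h3 := norm_stopAt_youngLin_sub_le (r := r) H hφ g ha hab hb K.2 fun t _ _ => hbd _
  refine h3.trans ?_
  have h4 := nnHolderNorm_vadd_le ℓ (basePath ξ T)
  have h5 : (K : ℝ) + youngConst lam γ * T ^ (lam : ℝ) *
      ((K * nnHolderNorm lam (ℓ +ᵥ basePath ξ T).1.1 : ℝ≥0) : ℝ) ≤
      (K + youngConst lam γ * T ^ (lam : ℝ) * K * (1 + B)) * (1 + ‖ℓ‖) := by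
    rw [NNReal.coe_mul, ← mul_assoc]
    have h6 := mul_le_mul_of_nonneg_left h4 hC
    have h7 := mul_nonneg hC (mul_nonneg hB0 (norm_nonneg ℓ))
    have h8 := mul_nonneg K.coe_nonneg (norm_nonneg ℓ)
    linarith
  rw [mul_right_comm _ _ (1 + ‖ℓ‖), mul_right_comm _ ‖g‖ (1 + ‖ℓ‖)]
  exact mul_le_mul_of_nonneg_right (mul_le_mul_of_nonneg_right h5 (norm_nonneg g)) hd

/-- Local Lipschitz continuity of the right-hand side, with a small constant over short time
intervals. -/
theorem exists_norm_stopAt_rhs_sub_rhs_le (H : YoungSetting lam γ T) (h1 : Hypothesis1 f)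
    (h2 : Hypothesis2 T f) (ξ : HolderPath lam (-(r : ℝ)) 0 V) (g : HolderZero γ 0 0 T F) (R : ℝ) :
    ∃ c : ℝ≥0, ∀ a b : ℝ, ∀ ℓ ℓ' : Direction lam r V T, 0 ≤ a → a ≤ b → b ≤ T → ‖ℓ‖ ≤ R →
      ‖ℓ'‖ ≤ R → stopAt a ℓ = stopAt a ℓ' →
      ‖stopAt b (rhs H h1 ξ g ℓ) - stopAt b (rhs H h1 ξ g ℓ')‖ ≤
        youngGain lam γ T * c * ‖g‖ * (b - a) ^ ((γ : ℝ) - lam) * ‖ℓ - ℓ'‖ := by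
  obtain ⟨c, hc⟩ := h2 (max 1 (Real.toNNReal (R + nnHolderNorm lam (basePath ξ T).1.1)))
    (le_max_left _ _)
  refine ⟨c, fun a b ℓ ℓ' ha hab hb hℓ hℓ' h => ?_⟩
  have hle : ∀ {m : Direction lam r V T}, ‖m‖ ≤ R → nnHolderNorm lam (m +ᵥ basePath ξ T).1.1 ≤
      max 1 (Real.toNNReal (R + nnHolderNorm lam (basePath ξ T).1.1)) := fun {m} hm =>
    le_max_of_le_right (NNReal.le_toNNReal_of_coe_le ((nnHolderNorm_vadd_le m _).trans
      (by linarith)))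
  have hold := hc 0 T le_rfl H.pos.le le_rfl (ℓ +ᵥ basePath ξ T).1 (ℓ' +ᵥ basePath ξ T).1
    (fun t ht => by
      rw [vadd_apply, vadd_apply, ℓ.2.2 t (ht.trans (le_max_right _ _)),
        ℓ'.2.2 t (ht.trans (le_max_right _ _))]) (max_le (hle hℓ) (hle hℓ'))
  have hnorm : (nnHolderNorm lam ((ℓ +ᵥ basePath ξ T).1.1 - (ℓ' +ᵥ basePath ξ T).1.1) : ℝ) =
      ‖ℓ - ℓ'‖ := by
    rw [norm_def]
    congr 2
    exact funext fun t => add_sub_add_right_eq_sub _ _ _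
  have hsub : stopAt b (rhs H h1 ξ g ℓ) - stopAt b (rhs H h1 ξ g ℓ') =
      stopAt b (youngLin H (coeffPath h1 (ℓ +ᵥ basePath ξ T) -
        coeffPath h1 (ℓ' +ᵥ basePath ξ T)) g) := by
    rw [rhs, rhs, ← map_sub, map_sub (youngLin H), LinearMap.sub_apply]
  rw [hsub]
  have h3 := norm_stopAt_youngLin_le (r := r) H (φ := coeffPath h1 (ℓ +ᵥ basePath ξ T) -
    coeffPath h1 (ℓ' +ᵥ basePath ξ T)) hold g ha hab hb fun t ht =>
      sub_eq_zero.2 (delayMap_vadd_congr f _ ha h t ht)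
  rw [NNReal.coe_mul, hnorm] at h3
  refine h3.trans (le_of_eq ?_)
  ring

/-- Existence and uniqueness for the Young delay equation, in fixed point form. -/
theorem existsUnique_rhs_eq (H : YoungSetting lam γ T) (h1 : Hypothesis1 f)
    (h2 : Hypothesis2 T f) (ξ : HolderPath lam (-(r : ℝ)) 0 V) (g : HolderZero γ 0 0 T F) :
    ∃! ℓ : Direction lam r V T, rhs H h1 ξ g ℓ = ℓ := by
  obtain ⟨K, hK, hbd, hlip⟩ := id h1
  lift K to ℝ≥0 using hK.le
  obtain ⟨δ₀, hδ₀, hsmall₀⟩ := exists_forall_mul_rpow_le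
    ((K + youngConst lam γ * T ^ (lam : ℝ) * K * (1 + nnHolderNorm lam (basePath ξ T).1.1)) * ‖g‖)
    H.sub_pos one_half_pos
  refine (isStopping (by simp)).existsUnique_fixedPoint H.pos.le ?_ hδ₀ ?_ ?_
  · intro τ ℓ ℓ' hτ _ h
    exact stopAt_youngLin_congr H g hτ fun s hs => delayMap_vadd_congr f _ hτ h s hs
  · intro a b ℓ ha hab hb hba
    refine (norm_stopAt_rhs_sub_le H h1 hbd hlip g ℓ ha hab hb).trans ?_
    exact mul_le_mul_of_nonneg_right (hsmall₀ (b - a) (by linarith) hba) (by positivity)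
  · intro R
    obtain ⟨c, hc⟩ := exists_norm_stopAt_rhs_sub_rhs_le H h1 h2 ξ g R
    obtain ⟨δ, hδ, hsmall⟩ := exists_forall_mul_rpow_le
      (youngGain lam γ T * c * ‖g‖) H.sub_pos one_half_pos
    refine ⟨δ, hδ, fun a b ℓ ℓ' ha hab hb hba hℓ hℓ' h => ?_⟩
    refine (hc a b ℓ ℓ' ha hab hb hℓ hℓ' h).trans ?_
    exact mul_le_mul_of_nonneg_right (hsmall (b - a) (by linarith) hba) (norm_nonneg _)

/-- The operator `Z ↦ ∫ A(Z) dg` in the linearized equation. -/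
def linearPart (H : YoungSetting lam γ T) (g : HolderZero γ 0 0 T F)
    (A : Direction lam r V T →L[ℝ] HolderZero lam 0 0 T (F →L[ℝ] V)) :
    Direction lam r V T →L[ℝ] Direction lam r V T :=
  ((youngCLM H).flip g).comp A

theorem linearPart_apply (H : YoungSetting lam γ T) (g : HolderZero γ 0 0 T F)
    (A : Direction lam r V T →L[ℝ] HolderZero lam 0 0 T (F →L[ℝ] V)) (Z : Direction lam r V T) :
    linearPart H g A Z = youngLin H (toHolderPath (A Z)) g := rfl

theorem isLinearSolution_iff (H : YoungSetting lam γ T) (h1 : Hypothesis1 f)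
    (x : HolderPath γ 0 T F) (h k : HolderZero γ 0 0 T F) (y : DelayedPath ξ T)
    (A : Direction lam r V T →L[ℝ] HolderZero lam 0 0 T (F →L[ℝ] V)) (Z : Direction lam r V T) :
    IsLinearSolution f (x.1 + h.1) y A k.1 Z ↔
      (ContinuousLinearMap.id ℝ (Direction lam r V T) -
        linearPart H (centered H.pos x + h) A) Z =
        youngRight H (coeffPath h1 y) k := by
  have hI := fun I => isYoungIntegral_iff (r := r) H (coeffPath h1 y) k (I := I)
  have hJ := fun J => isYoungIntegral_add_iff (r := r) H (toHolderPath (A Z)) x h (I := J)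
  have e : (ContinuousLinearMap.id ℝ (Direction lam r V T) -
        linearPart H (centered H.pos x + h) A) Z =
      Z - youngLin H (toHolderPath (A Z)) (centered H.pos x + h) := rfl
  rw [e, youngRight_apply, sub_eq_iff_eq_add]
  constructor
  · rintro ⟨I, J, hI', hJ', hZ⟩
    refine Direction.ext_incl fun t => ?_
    rw [hZ, HolderZero.add_apply, (hI I).1 hI' t, (hJ J).1 hJ' t]
  · intro hZ
    refine ⟨_, _, (hI _).2 fun t => rfl, (hJ _).2 fun t => rfl, fun t => ?_⟩
    rw [← HolderZero.add_apply, ← hZ]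

theorem isInvertible_id_sub_linearPart (H : YoungSetting lam γ T) (h1 : Hypothesis1 f)
    (g : HolderZero γ 0 0 T F) {ℓ : Direction lam r V T}
    {A : Direction lam r V T →L[ℝ] HolderZero lam 0 0 T (F →L[ℝ] V)}
    (hA : HasDelayMapDerivAt f (ℓ +ᵥ basePath ξ T) A) :
    (ContinuousLinearMap.id ℝ _ - linearPart H g A).IsInvertible := by
  obtain ⟨δ, hδ, hsmall⟩ := exists_forall_mul_rpow_le
    (youngGain lam γ T * ‖A‖ * ‖g‖) H.sub_pos (show (0 : ℝ) < 1 / 4 by norm_num)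
  refine (isStopping (by simp)).isInvertible_id_sub H.pos.le ?_ hδ ?_
  · intro τ Z hτ _ hZ
    rw [linearPart_apply]
    have := stopAt_youngLin_congr (r := r) H (φ := toHolderPath (A Z)) (ψ := 0) g hτ
      fun s hs => hA.stopAt_eq_zero h1 hτ hZ s hs
    rw [this, map_zero, LinearMap.zero_apply, map_zero]
  · intro a b Z ha hab hb hba hZ
    rw [linearPart_apply]
    have h3 := norm_stopAt_youngLin_le (r := r) H (φ := toHolderPath (A Z)) (A Z).2.1.holderWith g
      ha hab hb fun s hs => hA.stopAt_eq_zero h1 ha hZ s hs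
    rw [← norm_def] at h3
    have hd := Real.rpow_nonneg (show 0 ≤ b - a by linarith) ((γ : ℝ) - lam)
    have hG := H.youngGain_nonneg
    calc _ ≤ _ := h3
      _ ≤ youngGain lam γ T * (‖A‖ * ‖Z‖) * ‖g‖ * (b - a) ^ ((γ : ℝ) - lam) := by
        gcongr
        exact A.le_opNorm Z
      _ = youngGain lam γ T * ‖A‖ * ‖g‖ * (b - a) ^ ((γ : ℝ) - lam) * ‖Z‖ := by ring
      _ ≤ _ := by
        gcongr
        exact hsmall (b - a) (by linarith) hba

/-- Differentiability of the unique solution `L h` of `ℓ = B₀ (g₀ + h) + B (u ℓ) (g₀ + h)`: the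
implicit function theorem gives local solutions that depend differentiably on `h`, and these are
identified with the global ones by uniqueness. -/
theorem hasFDerivAt_fixedPoint {P X Y : Type*} [NormedAddCommGroup P] [NormedSpace ℝ P]
    [CompleteSpace P] [NormedAddCommGroup X] [NormedSpace ℝ X] [CompleteSpace X]
    [NormedAddCommGroup Y] [NormedSpace ℝ Y] (B₀ : P →L[ℝ] X) (B : Y →L[ℝ] P →L[ℝ] X) {u : X → Y}
    {g₀ : P} {L : P → X} (hL : ∀ h, B₀ (g₀ + h) + B (u (L h)) (g₀ + h) = L h)
    (huniq : ∀ h ℓ, B₀ (g₀ + h) + B (u ℓ) (g₀ + h) = ℓ → ℓ = L h) {h : P} {A : X →L[ℝ] Y}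
    (hu : HasStrictFDerivAt u A (L h))
    (hinv : (ContinuousLinearMap.id ℝ X - (B.flip (g₀ + h)).comp A).IsInvertible) :
    HasFDerivAt L ((ContinuousLinearMap.id ℝ X - (B.flip (g₀ + h)).comp A).inverse.comp
      (B₀ + B (u (L h)))) h := by
  set Ψ : P × X → X := fun p => p.2 - (B₀ (g₀ + p.1) + B (u p.2) (g₀ + p.1)) with hΨ
  have hΨ0 : ∀ k ℓ, Ψ (k, ℓ) = 0 ↔ B₀ (g₀ + k) + B (u ℓ) (g₀ + k) = ℓ := fun k ℓ => by
    rw [hΨ, sub_eq_zero, eq_comm]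
  have hfst : HasStrictFDerivAt (fun p : P × X => g₀ + p.1) (ContinuousLinearMap.fst ℝ P X)
      (h, L h) := hasStrictFDerivAt_fst.const_add g₀
  have hBu : HasStrictFDerivAt (fun p : P × X => B (u p.2))
      (B.comp (A.comp (ContinuousLinearMap.snd ℝ P X))) (h, L h) :=
    B.hasStrictFDerivAt.comp (h, L h) (hu.comp (h, L h) hasStrictFDerivAt_snd)
  set D : P × X →L[ℝ] X := ContinuousLinearMap.snd ℝ P X -
    (B₀.comp (ContinuousLinearMap.fst ℝ P X) +
      ((B (u (L h))).comp (ContinuousLinearMap.fst ℝ P X) +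
        (B.comp (A.comp (ContinuousLinearMap.snd ℝ P X))).flip (g₀ + h)))
  have hD : HasStrictFDerivAt Ψ D (h, L h) :=
    hasStrictFDerivAt_snd.sub ((B₀.hasStrictFDerivAt.comp (h, L h) hfst).add (hBu.clm_apply hfst))
  have hinr : D ∘L ContinuousLinearMap.inr ℝ P X =
      ContinuousLinearMap.id ℝ X - (B.flip (g₀ + h)).comp A := by
    ext1 Z
    change Z - (B₀ 0 + (B (u (L h)) 0 + B (A Z) (g₀ + h))) = Z - B (A Z) (g₀ + h)
    rw [map_zero, map_zero, zero_add, zero_add]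
  have hinl : D ∘L ContinuousLinearMap.inl ℝ P X = -(B₀ + B (u (L h))) := by
    ext1 k
    change 0 - (B₀ k + (B (u (L h)) k + B (A 0) (g₀ + h))) = -(B₀ k + B (u (L h)) k)
    rw [map_zero, map_zero, zero_sub, zero_apply, add_zero]
  rw [← hinr] at hinv
  have hψ := (hD.hasStrictFDerivAt_implicitFunctionOfProdDomain hinv).hasFDerivAt
  rw [hinr, hinl, ContinuousLinearMap.comp_neg, neg_neg] at hψ
  refine hψ.congr_of_eventuallyEq ?_
  filter_upwards [hD.eventually_apply_implicitFunctionOfProdDomain hinv] with k hk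
  rw [(hΨ0 h (L h)).2 (hL h), hΨ0] at hk
  exact (huniq k _ hk).symm

/-- The solution map of the Young delay equation is differentiable, and its derivative is obtained
by inverting the linearized equation. -/
theorem hasFDerivAt_of_rhs_eq [CompleteSpace F] (H : YoungSetting lam γ T) (h1 : Hypothesis1 f)
    (h2 : Hypothesis2 T f) (x : HolderPath γ 0 T F)
    {DU : ∀ t : ℝ, DelayedPath ξ t →
      (Direction lam r V t →L[ℝ] HolderZero lam 0 0 t (F →L[ℝ] V))}
    (h3 : Hypothesis3 f ξ x.1 DU) {L : HolderZero γ 0 0 T F → Direction lam r V T}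
    (hL : ∀ h, rhs H h1 ξ (centered H.pos x + h) (L h) = L h) (h : HolderZero γ 0 0 T F) :
    HasFDerivAt L
      ((ContinuousLinearMap.id ℝ _ - linearPart H (centered H.pos x + h)
        (DU T (L h +ᵥ basePath ξ T))).inverse.comp
        (youngRight H (coeffPath h1 (L h +ᵥ basePath ξ T)))) h := by
  set φ₀ := coeffPath h1 (basePath ξ T) with hφ₀
  have hsplit : ∀ ℓ : Direction lam r V T, youngRight (r := r) (γ := γ) H
      (coeffPath h1 (ℓ +ᵥ basePath ξ T)) =
        youngRight H φ₀ + youngCLM H (coeffIncrement h1 ξ ℓ) := by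
    intro ℓ
    have : coeffPath h1 (ℓ +ᵥ basePath ξ T) = φ₀ + toHolderPath (coeffIncrement h1 ξ ℓ) :=
      Subtype.ext (funext fun s => (add_sub_cancel _ _).symm)
    ext1 g
    rw [youngRight_apply, this, map_add, LinearMap.add_apply]
    rfl
  have hrhs : ∀ g ℓ, rhs H h1 ξ g ℓ =
      youngRight H φ₀ g + youngCLM H (coeffIncrement h1 ξ ℓ) g := fun g ℓ =>
    congrArg (fun B : HolderZero γ 0 0 T F →L[ℝ] Direction lam r V T => B g) (hsplit ℓ)
  rw [hsplit]
  simp only [hrhs] at hL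
  refine hasFDerivAt_fixedPoint (youngRight H φ₀) (youngCLM H) hL (fun k ℓ hk => ?_)
    (h3.hasStrictFDerivAt H.pos h1 (L h))
    (isInvertible_id_sub_linearPart H h1 _ (h3.hasDeriv T H.pos le_rfl _))
  simp only [← hrhs] at hL hk
  exact (existsUnique_rhs_eq H h1 h2 ξ _).unique hk (hL k)

end Equation

end YoungDelay

end

open YoungDelay

/-! ### Differentiability of the solution map -/

theorem mainTheorem5 (n d : ℕ) (T : ℝ) (hT : 0 < T) (r γ lam : ℝ≥0)
    (hlam : 1 / 2 < lam) (hγ : lam < γ)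
    (f : HolderPath lam (-(r : ℝ)) 0 (EuclideanSpace ℝ (Fin n)) →
      EuclideanSpace ℝ (Fin d) →L[ℝ] EuclideanSpace ℝ (Fin n))
    (ξ : HolderPath lam (-(r : ℝ)) 0 (EuclideanSpace ℝ (Fin n)))
    (x : HolderPath γ 0 T (EuclideanSpace ℝ (Fin d)))
    (DU : ∀ t : ℝ, DelayedPath ξ t →
      (Direction lam r (EuclideanSpace ℝ (Fin n)) t →L[ℝ]
        HolderZero lam 0 0 t (EuclideanSpace ℝ (Fin d) →L[ℝ] EuclideanSpace ℝ (Fin n))))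
    (h1 : Hypothesis1 f) (h2 : Hypothesis2 T f) (h3 : Hypothesis3 f ξ x.1 DU) :
    ∃ y : HolderZero γ 0 0 T (EuclideanSpace ℝ (Fin d)) → DelayedPath ξ T,
      (∀ h, IsSolution f (x.1 + h.1) (y h) ∧
        ∀ z : DelayedPath ξ T, IsSolution f (x.1 + h.1) z → z = y h) ∧
      ∃ Dy : HolderZero γ 0 0 T (EuclideanSpace ℝ (Fin d)) →
          (HolderZero γ 0 0 T (EuclideanSpace ℝ (Fin d)) →L[ℝ]
            Direction lam r (EuclideanSpace ℝ (Fin n)) T),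
        ∀ h, HasFDerivAt (fun h' => y h' -ᵥ y h) (Dy h) h ∧
          ∀ k, IsLinearSolution f (x.1 + h.1) (y h) (DU T (y h)) k.1 (Dy h k) ∧
            ∀ Z : Direction lam r (EuclideanSpace ℝ (Fin n)) T,
              IsLinearSolution f (x.1 + h.1) (y h) (DU T (y h)) k.1 Z → Z = Dy h k := by
  have H : YoungSetting lam γ T := ⟨hT, hlam, hγ⟩
  have hex := fun h => existsUnique_rhs_eq H h1 h2 ξ (centered H.pos x + h)
  choose L hL hLuniq using hex
  refine ⟨fun h => L h +ᵥ basePath ξ T, fun h => ⟨(isSolution_iff H h1 x h (L h)).2 (hL h),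
    fun z hz => ?_⟩, fun h => (ContinuousLinearMap.id ℝ _ - linearPart H (centered H.pos x + h)
      (DU T (L h +ᵥ basePath ξ T))).inverse.comp
        (youngRight H (coeffPath h1 (L h +ᵥ basePath ξ T))),
    fun h => ⟨?_, fun k => ⟨?_, fun Z hZ => ?_⟩⟩⟩
  · rw [← vsub_vadd_eq z (basePath ξ T)] at hz ⊢
    rw [hLuniq h _ ((isSolution_iff H h1 x h _).1 hz)]
  · simp only [vadd_vsub_vadd_eq]
    exact (hasFDerivAt_of_rhs_eq H h1 h2 x h3 hL h).sub_const (L h)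
  all_goals
    have hinv := isInvertible_id_sub_linearPart H h1 (centered H.pos x + h)
      (h3.hasDeriv T H.pos le_rfl (L h +ᵥ basePath ξ T))
    have happ : ∀ W, (ContinuousLinearMap.id ℝ (Direction lam r (EuclideanSpace ℝ (Fin n)) T) -
      linearPart H (centered H.pos x + h)
        (DU T (L h +ᵥ basePath ξ T))) ((ContinuousLinearMap.id ℝ _ - linearPart H
          (centered H.pos x + h) (DU T (L h +ᵥ basePath ξ T))).inverse W) = W :=
      fun W => hinv.self_apply_inverse W
  · exact (isLinearSolution_iff H h1 x h k _ _ _).2 (happ _)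
  · exact hinv.injective (((isLinearSolution_iff H h1 x h k _ _ _).1 hZ).trans (happ _).symm)
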